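/- Fix an integer $n\ge 2$, let $q$ be a formal variable, and for $m\in\mathbb Z$ put $[m]=\frac{q^m-q^{-m}}{q-q^{-1}}\in\mathbb Z[q,q^{-1}]$. *Knotted graphs.* A balanced-oriented knotted 4-valent graph $L$ (with rigid vertices; closed components without vertices are allowed) is given by an oriented plane diagram $D$ with finitely many crossings and finitely many 4-valent vertices, two edges entering and two leaving each vertex, so that a vertex has cyclic type In-In-Out-Out or In-Out-In-Out. Two diagrams represent the same $L$ (are rigid-vertex isotopic) if they are related by planar isotopy, the Reidemeister moves $R1,R2,R3$, the move $R4$ (a strand passes over or under a vertex) and the move $R5$ (a rigid vertex makes a half turn, which carries a crossing of two adjacent legs to the two opposite legs), with all orientations. The mirror image $\tilde L$ is represented by the diagram $\tilde D$ obtained from a diagram $D$ of $L$ by switching all crossings. *The polynomial.* Let $X_+,X_-$ be a positive and a negative crossing, $S$ the oriented smoothing, $V$ the In-In-Out-Out vertex with the same four ends, and write $V_i$ for an In-In-Out-Out vertex between the $i$-th and $(i+1)$-st of several vertical strands and $E_i$ for a maximum below a minimum at these two strands (products are stacked). $P(D)\in\mathbb Z[q,q^{-1}]$ is the value obtained by evaluating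 $D$, up to planar isotopy, with $P(\varnothing)=1$ and the following local relations: 1. $P(X_+)=q^{n-1}P(S)-q^{n}P(V)$ and $P(X_-)=q^{1-n}P(S)-q^{-n}P(V)$; 2. an In-Out-In-Out vertex is the sum of its two oriented smoothings; 3. a circle is $[n]$ times the empty picture; 4. a strand with a loop at an In-In-Out-Out vertex (on either side) is $[n-1]$ times the strand; 5. a bigon $V\cdot V$ with parallel edges is $[2]\,V$; 6. a bigon $V_1V_1$ between two antiparallel strands is $\mathrm{id}+[n-2]E_1$; 7. $V_1V_2V_1+V_2=V_2V_1V_2+V_1$ for three parallel strands; 8. $V_1V_2V_1+[n-3]E_2=V_2V_1V_2+[n-3]E_1$ for three strands of alternating orientations. Put $P(L):=P(D)$, where $D$ is a diagram of $L$. **Proposition.** Let $L$ be a balanced-oriented knotted 4-valent graph. Then $P(D)=P(L)$ for every diagram $D$ representing $L$, and the polynomial of the mirror image is obtained from that of $L$ by interchanging $q$ and $q^{-1}$: $$P(\tilde L)(q)=P(L)(q^{-1}).$$ -/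

import Mathlib

/-!
# Knotted balanced-oriented 4-valent graphs and their `sl(n)` polynomial

A plane diagram in general position with respect to the height function is a finite sequence of
elementary horizontal slices, read from bottom to top.  Each slice contains one elementary piece
(a minimum, a maximum, a crossing or a 4-valent vertex) and vertical strands to the left and to
the right of it.  Strands are oriented: `true` means upwards, `false` means downwards.
-/

namespace SlGraph

/-! ### Diagrams -/

/-- Balanced-oriented 4-valent vertices, drawn with two legs at the bottom and two at the top.
`iioo a b` has cyclic type In-In-Out-Out: its bottom legs are oriented `a`, `b` and its top legs
`b`, `a` (each leg continues the opposite one).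
`ioio a` has cyclic type In-Out-In-Out: its bottom legs are oriented `a`, `!a` and its top legs
`a`, `!a`. -/
inductive Vertex where
  | iioo (a b : Bool)
  | ioio (a : Bool)

/-- A node of a diagram: a crossing or a vertex of the graph.  In `crossing o a b` a strand
oriented `a` runs from bottom left to top right, a strand oriented `b` runs from bottom right to
top left, and the first of them is the over-strand exactly if `o` is `true`. -/
inductive Node where
  | crossing (o a b : Bool)
  | vertex (v : Vertex)

namespace Node

/-- Orientation of the bottom left leg. -/
def bl : Node → Bool
  | crossing _ a _ => a
  | vertex (.iioo a _) => a
  | vertex (.ioio a) => a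

/-- Orientation of the bottom right leg. -/
def br : Node → Bool
  | crossing _ _ b => b
  | vertex (.iioo _ b) => b
  | vertex (.ioio a) => !a

/-- Orientation of the top left leg. -/
def tl : Node → Bool
  | crossing _ _ b => b
  | vertex (.iioo _ b) => b
  | vertex (.ioio a) => a

/-- Orientation of the top right leg. -/
def tr : Node → Bool
  | crossing _ a _ => a
  | vertex (.iioo a _) => a
  | vertex (.ioio a) => !a

/-- The node rotated counterclockwise by a quarter turn in the plane: the old top left leg is the
new bottom left one, the old bottom left leg is the new bottom right one, and so on. -/
def rot : Node → Node
  | crossing o a b => crossing (!o) (!b) a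
  | vertex (.iioo a b) => vertex (.iioo (!b) a)
  | vertex (.ioio a) => vertex (.ioio (!a))

/-- Switch over-strand and under-strand at a crossing; leave vertices alone. -/
def mirror : Node → Node
  | crossing o a b => crossing (!o) a b
  | vertex v => vertex v

end Node

/-- The vertex turned by a half turn in space about its vertical axis. -/
def Vertex.flip : Vertex → Vertex
  | .iioo a b => .iioo b a
  | .ioio a => .ioio (!a)

/-- Elementary pieces.  `cup d` is a minimum with left leg `d` and right leg `!d`;
`cap d` is a maximum with left leg `d` and right leg `!d`. -/
inductive Gen where
  | cup (d : Bool)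
  | cap (d : Bool)
  | node (x : Node)

namespace Gen

/-- Orientations of the strands at the bottom of an elementary piece, from left to right. -/
def dom : Gen → List Bool
  | cup _ => []
  | cap d => [d, !d]
  | node x => [x.bl, x.br]

/-- Orientations of the strands at the top of an elementary piece, from left to right. -/
def cod : Gen → List Bool
  | cup d => [d, !d]
  | cap _ => []
  | node x => [x.tl, x.tr]

/-- Crossing switch. -/
def mirror : Gen → Gen
  | cup d => cup d
  | cap d => cap d
  | node x => node x.mirror

end Gen

/-- A horizontal slice: vertical strands `left`, then the piece `gen`, then vertical strands
`right`. -/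
@[ext] structure Slice where
  left : List Bool
  gen : Gen
  right : List Bool

namespace Slice

/-- Strands at the bottom of a slice. -/
def dom (s : Slice) : List Bool := s.left ++ s.gen.dom ++ s.right

/-- Strands at the top of a slice. -/
def cod (s : Slice) : List Bool := s.left ++ s.gen.cod ++ s.right

/-- Put more vertical strands to the left and to the right of a slice. -/
def whisker (L R : List Bool) (s : Slice) : Slice := ⟨L ++ s.left, s.gen, s.right ++ R⟩

/-- Crossing switch. -/
def mirror (s : Slice) : Slice := ⟨s.left, s.gen.mirror, s.right⟩

end Slice

/-- Sequences of slices, from bottom to top. -/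
abbrev Word := List Slice

/-- `IsTangle a w b`: the slices of `w` fit together to a tangle diagram with strands `a` at the
bottom and `b` at the top. -/
def IsTangle : List Bool → Word → List Bool → Prop
  | a, [], b => a = b
  | a, s :: w, b => a = s.dom ∧ IsTangle s.cod w b

/-- Diagrams of knotted balanced-oriented 4-valent graphs: closed sequences of slices. -/
structure Diagram where
  word : Word
  closed : IsTangle [] word []

/-- The surroundings of a small region of a diagram: slices `pre` below it, slices `post` above
it, and vertical strands `left` and `right` beside it. -/
structure Context where
  pre : Word
  left : List Bool
  right : List Bool
  post : Word

/-- Insert a local picture into its surroundings. -/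
def Context.fill (c : Context) (w : Word) : Word :=
  c.pre ++ w.map (Slice.whisker c.left c.right) ++ c.post

/-! ### Abbreviations for local pictures

In each of them `L` and `R` are the strands to the left and to the right. -/

/-- A minimum. -/
abbrev cupAt (L : List Bool) (d : Bool) (R : List Bool) : Slice := ⟨L, .cup d, R⟩

/-- A maximum. -/
abbrev capAt (L : List Bool) (d : Bool) (R : List Bool) : Slice := ⟨L, .cap d, R⟩

/-- A node. -/
abbrev nodeAt (L : List Bool) (x : Node) (R : List Bool) : Slice := ⟨L, .node x, R⟩

/-- A crossing. -/
abbrev crossAt (L : List Bool) (o a b : Bool) (R : List Bool) : Slice :=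
  ⟨L, .node (.crossing o a b), R⟩

/-- A vertex. -/
abbrev vertexAt (L : List Bool) (v : Vertex) (R : List Bool) : Slice := ⟨L, .node (.vertex v), R⟩

/-- A vertex of type In-In-Out-Out. -/
abbrev iiooAt (L : List Bool) (a b : Bool) (R : List Bool) : Slice := vertexAt L (.iioo a b) R

/-! ### Planar isotopy, Reidemeister moves, knotted graphs -/

/-- Local moves generating planar isotopy: pieces side by side exchange their heights, a minimum
and a maximum cancel, a node is rotated by a quarter turn. -/
inductive PlanarMove : Word → Word → Prop
  | interchange (g h : Gen) (M : List Bool) :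
      PlanarMove [⟨[], g, M ++ h.dom⟩, ⟨g.cod ++ M, h, []⟩]
        [⟨g.dom ++ M, h, []⟩, ⟨[], g, M ++ h.cod⟩]
  | zigzag_right (a : Bool) : PlanarMove [cupAt [a] (!a) [], capAt [] a [a]] []
  | zigzag_left (a : Bool) : PlanarMove [cupAt [] a [a], capAt [a] (!a) []] []
  | rotate (x : Node) :
      PlanarMove [nodeAt [] x.rot []]
        [cupAt [!x.tl, x.bl] x.br [], nodeAt [!x.tl] x [!x.br], capAt [] (!x.tl) [x.tr, !x.br]]

/-- The Reidemeister-type moves for 4-valent graphs with rigid vertices, with all orientations. -/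
inductive ReidemeisterMove : Word → Word → Prop
  | r1_right (o a : Bool) :
      ReidemeisterMove [cupAt [a] a [], crossAt [] o a a [!a], capAt [a] a []] []
  | r1_left (o a : Bool) :
      ReidemeisterMove [cupAt [] (!a) [a], crossAt [!a] o a a [], capAt [] (!a) [a]] []
  | r2 (o a b : Bool) : ReidemeisterMove [crossAt [] o a b [], crossAt [] (!o) b a []] []
  /-- `o₁₂`, `o₁₃`, `o₂₃` say which of the two strands involved is the upper one; the hypothesis
  says that the three strands lie in three different levels. -/
  | r3 (a b c o₁₂ o₁₃ o₂₃ : Bool) (h : o₁₂ = o₂₃ → o₁₃ = o₁₂) :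
      ReidemeisterMove [crossAt [] o₁₂ a b [c], crossAt [b] o₁₃ a c [], crossAt [] o₂₃ b c [a]]
        [crossAt [a] o₂₃ b c [], crossAt [] o₁₃ a c [b], crossAt [c] o₁₂ a b []]
  /-- A strand `e` passes over or under a vertex. -/
  | r4 (v : Vertex) (o e : Bool) :
      ReidemeisterMove
        [vertexAt [] v [e], crossAt [(Node.vertex v).tl] o (Node.vertex v).tr e [],
          crossAt [] o (Node.vertex v).tl e [(Node.vertex v).tr]]
        [crossAt [(Node.vertex v).bl] o (Node.vertex v).br e [],
          crossAt [] o (Node.vertex v).bl e [(Node.vertex v).br], vertexAt [e] v []]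
  /-- A rigid vertex makes a half turn. -/
  | r5 (v : Vertex) (o : Bool) :
      ReidemeisterMove
        [vertexAt [] v [], crossAt [] o (Node.vertex v).tl (Node.vertex v).tr []]
        [crossAt [] o (Node.vertex v).bl (Node.vertex v).br [], vertexAt [] v.flip []]

/-- Two diagrams that differ in a small region by a planar isotopy or a Reidemeister-type move. -/
def Diagram.Step (D D' : Diagram) : Prop :=
  ∃ (c : Context) (u v : Word), (PlanarMove u v ∨ ReidemeisterMove u v) ∧
    D.word = c.fill u ∧ D'.word = c.fill v

/-- Knotted balanced-oriented 4-valent graphs up to rigid-vertex isotopy: diagrams modulo the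
equivalence relation generated by planar isotopy and the Reidemeister-type moves. -/
def KnottedGraph := Quot Diagram.Step

/-- The knotted graph represented by a diagram. -/
def Diagram.graph (D : Diagram) : KnottedGraph := Quot.mk _ D

/-! ### Mirror images -/

theorem Slice.dom_mirror (s : Slice) : s.mirror.dom = s.dom := by
  rcases s with ⟨L, _ | _ | (_ | _), R⟩ <;> rfl

theorem Slice.cod_mirror (s : Slice) : s.mirror.cod = s.cod := by
  rcases s with ⟨L, _ | _ | (_ | _), R⟩ <;> rfl

theorem IsTangle.mirror : ∀ {w : Word} {a b : List Bool}, IsTangle a w b →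
    IsTangle a (w.map Slice.mirror) b
  | [], _, _, h => h
  | s :: _, _, _, h => ⟨h.1.trans s.dom_mirror.symm, by
      have := IsTangle.mirror h.2
      rwa [← s.cod_mirror] at this⟩

/-- The mirror image of a diagram: all crossings are switched. -/
def Diagram.mirror (D : Diagram) : Diagram := ⟨D.word.map Slice.mirror, D.closed.mirror⟩

/-- The mirrored surroundings. -/
def Context.mirror (c : Context) : Context :=
  ⟨c.pre.map Slice.mirror, c.left, c.right, c.post.map Slice.mirror⟩

theorem Context.mirror_fill (c : Context) (w : Word) :
    (c.fill w).map Slice.mirror = c.mirror.fill (w.map Slice.mirror) := by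
  simp [Context.fill, Context.mirror, Function.comp_def, Slice.mirror, Slice.whisker]

theorem Gen.dom_mirror (g : Gen) : g.mirror.dom = g.dom := by
  rcases g with _ | _ | (_ | _) <;> rfl

theorem Gen.cod_mirror (g : Gen) : g.mirror.cod = g.cod := by
  rcases g with _ | _ | (_ | _) <;> rfl

theorem PlanarMove.mirror {u v : Word} (h : PlanarMove u v) :
    PlanarMove (u.map Slice.mirror) (v.map Slice.mirror) := by
  cases h with
  | interchange g h M =>
    have := PlanarMove.interchange g.mirror h.mirror M
    simpa [Slice.mirror, Gen.dom_mirror, Gen.cod_mirror] using this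
  | zigzag_right a => exact .zigzag_right a
  | zigzag_left a => exact .zigzag_left a
  | rotate x =>
    rcases x with ⟨o, a, b⟩ | (⟨a, b⟩ | a)
    · exact .rotate (.crossing (!o) a b)
    · exact .rotate (.vertex (.iioo a b))
    · exact .rotate (.vertex (.ioio a))

theorem ReidemeisterMove.mirror {u v : Word} (h : ReidemeisterMove u v) :
    ReidemeisterMove (u.map Slice.mirror) (v.map Slice.mirror) := by
  cases h with
  | r1_right o a => exact .r1_right (!o) a
  | r1_left o a => exact .r1_left (!o) a
  | r2 o a b => exact .r2 (!o) a b
  | r3 a b c o₁₂ o₁₃ o₂₃ h =>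
    exact .r3 a b c (!o₁₂) (!o₁₃) (!o₂₃) (by simpa using h)
  | r4 v o e => exact .r4 v (!o) e
  | r5 v o => exact .r5 v (!o)

/-- The mirror image of a knotted graph. -/
def KnottedGraph.mirror : KnottedGraph → KnottedGraph :=
  Quot.map Diagram.mirror (by
    rintro D D' ⟨c, u, v, h, hD, hD'⟩
    refine ⟨c.mirror, u.map Slice.mirror, v.map Slice.mirror, h.imp (·.mirror) (·.mirror), ?_, ?_⟩
    · rw [← Context.mirror_fill, ← hD]; rfl
    · rw [← Context.mirror_fill, ← hD']; rfl)

/-! ### The polynomial -/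

open LaurentPolynomial Finsupp

/-- The quantum integer `[m] = (q ^ m - q ^ (-m)) / (q - q⁻¹)` as a Laurent polynomial in `q`, for
every integer `m`; `T k` is `q ^ k`. -/
noncomputable def qint (m : ℤ) : ℤ[T;T⁻¹] :=
  m.sign • ∑ i ∈ Finset.range m.natAbs, T ((m.natAbs : ℤ) - 1 - 2 * (i : ℤ))

theorem qint_mul (m : ℤ) : qint m * (T 1 - T (-1)) = T m - T (-m) := by
  have key : ∀ k : ℕ, (∑ i ∈ Finset.range k, T ((k : ℤ) - 1 - 2 * (i : ℤ)) : ℤ[T;T⁻¹]) *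
      (T 1 - T (-1)) = T (k : ℤ) - T (-(k : ℤ)) := by
    intro k
    have h := Finset.sum_range_sub' (fun i : ℕ => (T ((k : ℤ) - 2 * (i : ℤ)) : ℤ[T;T⁻¹])) k
    rw [show (k : ℤ) - 2 * ((0 : ℕ) : ℤ) = k by simp,
      show (k : ℤ) - 2 * (k : ℤ) = -(k : ℤ) by ring] at h
    rw [Finset.sum_mul, ← h]
    refine Finset.sum_congr rfl fun i _ => ?_
    rw [mul_sub, ← T_add, ← T_add]
    congr 2 <;> push_cast <;> ring
  rcases lt_trichotomy m 0 with h | h | h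
  · have := key m.natAbs
    rw [show ((m.natAbs : ℕ) : ℤ) = -m by omega] at this
    rw [qint, Int.sign_eq_neg_one_of_neg h, show ((m.natAbs : ℕ) : ℤ) = -m by omega, smul_mul_assoc,
      this]
    simp
  · subst h; simp [qint]
  · have := key m.natAbs
    rw [show ((m.natAbs : ℕ) : ℤ) = m by omega] at this
    rw [qint, Int.sign_eq_one_of_pos h, show ((m.natAbs : ℕ) : ℤ) = m by omega, smul_mul_assoc,
      this]
    simp

/-- The sign `±1` of a crossing. -/
def crossingSign (o a b : Bool) : ℤ := if o = (a == b) then 1 else -1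

/-- The oriented smoothing of a crossing with bottom legs `a`, `b`: two vertical strands if they
are parallel, a maximum below a minimum if they are antiparallel. -/
def smoothing (a b : Bool) : Word := if a = b then [] else [capAt [] a [], cupAt [] b []]

/-- A formal linear combination of local pictures with Laurent polynomials as coefficients. -/
abbrev Combination := Word →₀ ℤ[T;T⁻¹]

/-- The local relations.  A combination in this set is to evaluate to zero in all surroundings. -/
inductive LocalRelation (n : ℤ) : Combination → Prop
  /-- Diagrams are taken up to planar isotopy. -/
  | planar {u v : Word} (h : PlanarMove u v) : LocalRelation n (single u 1 - single v 1)
  /-- The skein relations for positive and for negative crossings. -/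
  | crossing (o a b : Bool) :
      LocalRelation n (single [crossAt [] o a b []] 1
        - (single (smoothing a b) (T (crossingSign o a b * (n - 1)))
          - single [iiooAt [] a b []] (T (crossingSign o a b * n))))
  /-- A vertex of type In-Out-In-Out is the sum of its two oriented smoothings. -/
  | ioio (a : Bool) :
      LocalRelation n (single [vertexAt [] (.ioio a) []] 1
        - (single [] 1 + single [capAt [] a [], cupAt [] a []] 1))
  /-- Circle `= [n]`. -/
  | circle (a : Bool) :
      LocalRelation n (single [cupAt [] a [], capAt [] a []] 1 - single [] (qint n))
  /-- Loop at a vertex `= [n - 1]` strand (loop to the right of the strand). -/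
  | loop_right (a : Bool) :
      LocalRelation n (single [cupAt [a] a [], iiooAt [] a a [!a], capAt [a] a []] 1
        - single [] (qint (n - 1)))
  /-- Loop at a vertex `= [n - 1]` strand (loop to the left of the strand). -/
  | loop_left (a : Bool) :
      LocalRelation n (single [cupAt [] (!a) [a], iiooAt [!a] a a [], capAt [] (!a) [a]] 1
        - single [] (qint (n - 1)))
  /-- Bigon with parallel edges `= [2]` vertex. -/
  | bigon_parallel (a : Bool) :
      LocalRelation n (single [iiooAt [] a a [], iiooAt [] a a []] 1
        - single [iiooAt [] a a []] (qint 2))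
  /-- Bigon with antiparallel edges. -/
  | bigon_antiparallel (a : Bool) :
      LocalRelation n (single [iiooAt [] a (!a) [], iiooAt [] (!a) a []] 1
        - (single [] 1 + single [capAt [] a [], cupAt [] a []] (qint (n - 2))))
  /-- Triangle whose boundary is not a directed cycle. -/
  | triangle_acyclic (a : Bool) :
      LocalRelation n
        ((single [iiooAt [] a a [a], iiooAt [a] a a [], iiooAt [] a a [a]] 1
            + single [iiooAt [a] a a []] 1)
          - (single [iiooAt [a] a a [], iiooAt [] a a [a], iiooAt [a] a a []] 1
            + single [iiooAt [] a a [a]] 1))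
  /-- Triangle whose boundary is a directed cycle. -/
  | triangle_cyclic (a : Bool) :
      LocalRelation n
        ((single [iiooAt [] a (!a) [a], iiooAt [!a] a a [], iiooAt [] (!a) a [a]] 1
            + single [capAt [a] (!a) [], cupAt [a] (!a) []] (qint (n - 3)))
          - (single [iiooAt [a] (!a) a [], iiooAt [] a a [!a], iiooAt [a] a (!a) []] 1
            + single [capAt [] a [a], cupAt [] a [a]] (qint (n - 3))))

/-- The submodule spanned by all instances of the local relations in closed diagrams. -/
noncomputable def skeinSubmodule (n : ℤ) : Submodule ℤ[T;T⁻¹] Combination :=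
  Submodule.span ℤ[T;T⁻¹] {y | ∃ (c : Context) (x : Combination), LocalRelation n x ∧
    (∀ w ∈ x.support, IsTangle [] (c.fill w) []) ∧ y = Finsupp.mapDomain c.fill x}

/-- The diagram `D` evaluates to the Laurent polynomial `p`: by means of the relations `D` can be
rewritten as `p` times the empty diagram. -/
def Diagram.Evaluates (n : ℤ) (D : Diagram) (p : ℤ[T;T⁻¹]) : Prop :=
  single D.word 1 - single [] p ∈ skeinSubmodule n

open Classical in
/-- The polynomial `P(D)` of a diagram: the Laurent polynomial to which `D` evaluates.
For `n ≥ 2` there is exactly one, by the existence and the uniqueness of the evaluation of planar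
graphs, so that the default value `0` is never used. -/
noncomputable def Diagram.P (n : ℤ) (D : Diagram) : ℤ[T;T⁻¹] :=
  if h : ∃ p, D.Evaluates n p then h.choose else 0

/-- The polynomial `P(L) := P(D)` of a knotted graph, where `D` is a diagram representing `L`. -/
noncomputable def KnottedGraph.P (n : ℤ) (L : KnottedGraph) : ℤ[T;T⁻¹] :=
  Diagram.P n (Quot.out L)

end SlGraph

/-!
The polynomial of a diagram `D` depends only on the set of Laurent polynomials to which `D`
evaluates, that is, on the class of `D` in the skein module, the free module on sequences of slices
modulo `skeinSubmodule n`. Hence two things have to be shown: diagrams related by a move have the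
same class, and the evaluation is unique, so that the value chosen for the mirror image is the
mirror image of the value chosen for the diagram.

Invariance. A local picture is regarded as a function of its surroundings (`val`), so that local
relations become linear equations that can be inserted into larger pictures (`val_congr`). The
moves are derived from the planar relations, the resolution of crossings, loops, bigons and the
acyclic triangle (`SkeinTheory`), by resolving crossings. This settles `R1`, `R2` and the move `R3`
for three parallel strands. Rotating the picture of `R3` by a sixth of a turn (`r3_rotate`) and
conjugating by crossings (`r3_swap_left`, `r3_swap_right`) gives all other orientations. As a
vertex is a combination of a crossing and a smoothing, `R4` follows from `R3` and from sliding a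
strand past a maximum or a minimum. Comparing the two resolved sides of `R3` for alternating
orientations shows that the relation for the cyclic triangle is a consequence of the other ones
(`SkeinTheory.triangle_cyclic`).

Uniqueness. The state sum of the vector representation of quantum `sl(N)` assigns to every closed
sequence of slices a Laurent polynomial, with value `1` on the empty one. It satisfies all local
relations (`skeinTheory_stateSum`; the cyclic triangle comes for free by the previous remark), so
it recovers `p` from the class of `p` times the empty diagram.

Mirror images. Switching all crossings and applying `q ↦ q⁻¹` to the coefficients permutes the
local relations (`LocalRelation.mirror`), since quantum integers are invariant under `q ↦ q⁻¹`.
-/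

namespace SlGraph

open LaurentPolynomial Finsupp

section Skein

/-! ### Typed local pictures -/

attribute [simp] IsTangle Slice.dom Slice.cod Slice.whisker

namespace Gen

@[simp] theorem dom_cup (d : Bool) : (cup d).dom = [] := rfl
@[simp] theorem dom_cap (d : Bool) : (cap d).dom = [d, !d] := rfl
@[simp] theorem dom_node (x : Node) : (node x).dom = [x.bl, x.br] := rfl
@[simp] theorem cod_cup (d : Bool) : (cup d).cod = [d, !d] := rfl
@[simp] theorem cod_cap (d : Bool) : (cap d).cod = [] := rfl
@[simp] theorem cod_node (x : Node) : (node x).cod = [x.tl, x.tr] := rfl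

end Gen

namespace Node

@[simp] theorem bl_crossing (o a b : Bool) : (crossing o a b).bl = a := rfl
@[simp] theorem br_crossing (o a b : Bool) : (crossing o a b).br = b := rfl
@[simp] theorem tl_crossing (o a b : Bool) : (crossing o a b).tl = b := rfl
@[simp] theorem tr_crossing (o a b : Bool) : (crossing o a b).tr = a := rfl
@[simp] theorem bl_iioo (a b : Bool) : (vertex (.iioo a b)).bl = a := rfl
@[simp] theorem br_iioo (a b : Bool) : (vertex (.iioo a b)).br = b := rfl
@[simp] theorem tl_iioo (a b : Bool) : (vertex (.iioo a b)).tl = b := rfl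
@[simp] theorem tr_iioo (a b : Bool) : (vertex (.iioo a b)).tr = a := rfl
@[simp] theorem bl_ioio (a : Bool) : (vertex (.ioio a)).bl = a := rfl
@[simp] theorem br_ioio (a : Bool) : (vertex (.ioio a)).br = !a := rfl
@[simp] theorem tl_ioio (a : Bool) : (vertex (.ioio a)).tl = a := rfl
@[simp] theorem tr_ioio (a : Bool) : (vertex (.ioio a)).tr = !a := rfl
@[simp] theorem rot_crossing (o a b : Bool) : (crossing o a b).rot = crossing (!o) (!b) a := rfl
@[simp] theorem rot_iioo (a b : Bool) : (vertex (.iioo a b)).rot = vertex (.iioo (!b) a) := rfl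
@[simp] theorem rot_ioio (a : Bool) : (vertex (.ioio a)).rot = vertex (.ioio (!a)) := rfl

end Node

theorem isTangle_append {u v : Word} {a c : List Bool} :
    IsTangle a (u ++ v) c ↔ ∃ b, IsTangle a u b ∧ IsTangle b v c := by
  induction u generalizing a with
  | nil => simp
  | cons s u ih => simp [ih, and_assoc]

theorem IsTangle.append {u v : Word} {a b c : List Bool} (hu : IsTangle a u b)
    (hv : IsTangle b v c) : IsTangle a (u ++ v) c :=
  isTangle_append.2 ⟨b, hu, hv⟩

theorem IsTangle.whisker (L R : List Bool) {w : Word} {a b : List Bool} (h : IsTangle a w b) :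
    IsTangle (L ++ a ++ R) (w.map (Slice.whisker L R)) (L ++ b ++ R) := by
  induction w generalizing a with
  | nil => simpa using h
  | cons s w ih =>
    refine ⟨by rw [h.1]; simp, ?_⟩
    have := ih h.2
    simpa using this

theorem IsTangle.right_unique {w : Word} {a b b' : List Bool} (h : IsTangle a w b)
    (h' : IsTangle a w b') : b = b' := by
  induction w generalizing a with
  | nil => exact h.symm.trans h'
  | cons s w ih => exact ih h.2 h'.2

theorem IsTangle.left_unique {w : Word} {a a' b b' : List Bool} (hw : w ≠ [])
    (h : IsTangle a w b) (h' : IsTangle a' w b') : a = a' := by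
  cases w with
  | nil => exact absurd rfl hw
  | cons s w => exact h.1.trans h'.1.symm

/-- A local picture with strands `a` at the bottom and `b` at the top can be inserted into `c` so
that a closed diagram results. -/
def Context.Fits (c : Context) (a b : List Bool) : Prop :=
  IsTangle [] c.pre (c.left ++ a ++ c.right) ∧ IsTangle (c.left ++ b ++ c.right) c.post []

/-- The surroundings `d` placed inside the surroundings `c`. -/
def Context.comp (c d : Context) : Context :=
  ⟨c.pre ++ d.pre.map (Slice.whisker c.left c.right), c.left ++ d.left, d.right ++ c.right,
    d.post.map (Slice.whisker c.left c.right) ++ c.post⟩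

theorem Context.comp_fill (c d : Context) (w : Word) : (c.comp d).fill w = c.fill (d.fill w) := by
  simp [Context.comp, Context.fill, Function.comp_def]

theorem Context.Fits.comp {c d : Context} {a b a' b' : List Bool} (hc : c.Fits a' b')
    (hpre : IsTangle a' d.pre (d.left ++ a ++ d.right))
    (hpost : IsTangle (d.left ++ b ++ d.right) d.post b') : (c.comp d).Fits a b := by
  refine ⟨?_, ?_⟩
  · have := hc.1.append (hpre.whisker c.left c.right)
    simpa [Context.comp] using this
  · have := (hpost.whisker c.left c.right).append hc.2
    simpa [Context.comp] using this

theorem Context.Fits.closed {c : Context} {a b : List Bool} (hc : c.Fits a b) {w : Word}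
    (hw : IsTangle a w b) : IsTangle [] (c.fill w) [] :=
  (hc.1.append (hw.whisker _ _)).append hc.2

/-- The surroundings determine which strands they can be attached to, unless the local picture
inside is empty. -/
theorem Context.fits_of_closed {c : Context} {a b : List Bool} {w : Word} (hw : IsTangle a w b)
    (hne : w ≠ []) (h : IsTangle [] (c.fill w) []) : c.Fits a b := by
  obtain ⟨m₂, h₁₂, h₃⟩ := isTangle_append.1 h
  obtain ⟨m₁, h₁, h₂⟩ := isTangle_append.1 h₁₂
  have hw' := hw.whisker c.left c.right
  obtain rfl : m₁ = _ := h₂.left_unique (by simpa using hne) hw'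
  obtain rfl : m₂ = _ := h₂.right_unique hw'
  exact ⟨h₁, h₃⟩

variable {M : Type*} [AddCommGroup M] [Module ℤ[T;T⁻¹] M]

/-- The local picture `w`, with strands `a` at the bottom and `b` at the top, as seen by an
invariant `ψ` of closed diagrams: the function sending the surroundings to the value of `ψ` on
the diagram with `w` inserted. -/
def val (ψ : Word → M) (a b : List Bool) (w : Word) : {c : Context // c.Fits a b} → M :=
  fun c => ψ (c.1.fill w)

/-- Insertion of local pictures into the surroundings `d`, as a linear map. -/
noncomputable def insertMap (M : Type*) [AddCommGroup M] [Module ℤ[T;T⁻¹] M]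
    {a b a' b' : List Bool} (d : Context)
    (hpre : IsTangle a' d.pre (d.left ++ a ++ d.right))
    (hpost : IsTangle (d.left ++ b ++ d.right) d.post b') :
    ({c : Context // c.Fits a b} → M) →ₗ[ℤ[T;T⁻¹]] ({c : Context // c.Fits a' b'} → M) :=
  LinearMap.funLeft _ _ fun c => ⟨c.1.comp d, c.2.comp hpre hpost⟩

@[simp] theorem insertMap_val (ψ : Word → M) {a b a' b' : List Bool} (d : Context)
    (hpre : IsTangle a' d.pre (d.left ++ a ++ d.right))
    (hpost : IsTangle (d.left ++ b ++ d.right) d.post b') (w : Word) :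
    insertMap M d hpre hpost (val ψ a b w) = val ψ a' b' (d.fill w) := by
  funext c
  simp [insertMap, LinearMap.funLeft, val, Context.comp_fill]

/-- An equation between local pictures remains valid with strands `L`, `R` beside them, `p` below
them and `q` above them. -/
theorem val_congr {ψ : Word → M} {a b : List Bool} {u v : Word} (h : val ψ a b u = val ψ a b v)
    (p q : Word) (L R : List Bool) {a' b' : List Bool} (hp : IsTangle a' p (L ++ a ++ R))
    (hq : IsTangle (L ++ b ++ R) q b') :
    val ψ a' b' (p ++ u.map (Slice.whisker L R) ++ q) =
      val ψ a' b' (p ++ v.map (Slice.whisker L R) ++ q) := by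
  simpa [Context.fill] using congrArg (insertMap M ⟨p, L, R, q⟩ hp hq) h

theorem val_congr_smul {ψ : Word → M} {a b : List Bool} {u v : Word} {r : ℤ[T;T⁻¹]}
    (h : val ψ a b u = r • val ψ a b v)
    (p q : Word) (L R : List Bool) {a' b' : List Bool} (hp : IsTangle a' p (L ++ a ++ R))
    (hq : IsTangle (L ++ b ++ R) q b') :
    val ψ a' b' (p ++ u.map (Slice.whisker L R) ++ q) =
      r • val ψ a' b' (p ++ v.map (Slice.whisker L R) ++ q) := by
  simpa [Context.fill] using congrArg (insertMap M ⟨p, L, R, q⟩ hp hq) h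

theorem val_congr_add {ψ : Word → M} {a b : List Bool} {u v w : Word} {r s : ℤ[T;T⁻¹]}
    (h : val ψ a b u = r • val ψ a b v + s • val ψ a b w)
    (p q : Word) (L R : List Bool) {a' b' : List Bool} (hp : IsTangle a' p (L ++ a ++ R))
    (hq : IsTangle (L ++ b ++ R) q b') :
    val ψ a' b' (p ++ u.map (Slice.whisker L R) ++ q) =
      r • val ψ a' b' (p ++ v.map (Slice.whisker L R) ++ q) +
        s • val ψ a' b' (p ++ w.map (Slice.whisker L R) ++ q) := by
  simpa [Context.fill] using congrArg (insertMap M ⟨p, L, R, q⟩ hp hq) h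

/-- An invariant of closed diagrams that satisfies all local relations except the one for a
triangle whose boundary is a directed cycle. -/
structure SkeinTheory (n : ℤ) (ψ : Word → M) : Prop where
  planar {u v : Word} {a b : List Bool} (h : PlanarMove u v) (hu : IsTangle a u b)
    (hv : IsTangle a v b) : val ψ a b u = val ψ a b v
  crossing (o a b : Bool) : val ψ [a, b] [b, a] [crossAt [] o a b []] =
    (T (crossingSign o a b * (n - 1)) : ℤ[T;T⁻¹]) • val ψ [a, b] [b, a] (smoothing a b) +
      (-T (crossingSign o a b * n) : ℤ[T;T⁻¹]) • val ψ [a, b] [b, a] [iiooAt [] a b []]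
  ioio (a : Bool) : val ψ [a, !a] [a, !a] [vertexAt [] (.ioio a) []] =
    (1 : ℤ[T;T⁻¹]) • val ψ [a, !a] [a, !a] [] +
      (1 : ℤ[T;T⁻¹]) • val ψ [a, !a] [a, !a] [capAt [] a [], cupAt [] a []]
  circle (a : Bool) : val ψ [] [] [cupAt [] a [], capAt [] a []] = qint n • val ψ [] [] []
  loop_right (a : Bool) : val ψ [a] [a] [cupAt [a] a [], iiooAt [] a a [!a], capAt [a] a []] =
    qint (n - 1) • val ψ [a] [a] []
  loop_left (a : Bool) : val ψ [a] [a] [cupAt [] (!a) [a], iiooAt [!a] a a [], capAt [] (!a) [a]] =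
    qint (n - 1) • val ψ [a] [a] []
  bigon_parallel (a : Bool) : val ψ [a, a] [a, a] [iiooAt [] a a [], iiooAt [] a a []] =
    qint 2 • val ψ [a, a] [a, a] [iiooAt [] a a []]
  bigon_antiparallel (a : Bool) :
    val ψ [a, !a] [a, !a] [iiooAt [] a (!a) [], iiooAt [] (!a) a []] =
      (1 : ℤ[T;T⁻¹]) • val ψ [a, !a] [a, !a] [] +
        qint (n - 2) • val ψ [a, !a] [a, !a] [capAt [] a [], cupAt [] a []]
  triangle_acyclic (a : Bool) :
    val ψ [a, a, a] [a, a, a] [iiooAt [] a a [a], iiooAt [a] a a [], iiooAt [] a a [a]] +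
        val ψ [a, a, a] [a, a, a] [iiooAt [a] a a []] =
      val ψ [a, a, a] [a, a, a] [iiooAt [a] a a [], iiooAt [] a a [a], iiooAt [a] a a []] +
        val ψ [a, a, a] [a, a, a] [iiooAt [] a a [a]]

variable {n : ℤ} {ψ : Word → M}

/-! ### Quarter turns -/

@[simp] theorem Node.bl_rot (x : Node) : x.rot.bl = !x.tl := by
  rcases x with _ | (_ | _) <;> rfl

@[simp] theorem Node.br_rot (x : Node) : x.rot.br = x.bl := by
  rcases x with _ | (_ | _) <;> simp

@[simp] theorem Node.tl_rot (x : Node) : x.rot.tl = x.tr := by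
  rcases x with _ | (_ | _) <;> simp

@[simp] theorem Node.tr_rot (x : Node) : x.rot.tr = !x.br := by
  rcases x with _ | (_ | _) <;> simp

namespace SkeinTheory

theorem interchange (S : SkeinTheory n ψ) (g h : Gen) (m : List Bool) :
    val ψ (g.dom ++ m ++ h.dom) (g.cod ++ m ++ h.cod)
        [⟨[], g, m ++ h.dom⟩, ⟨g.cod ++ m, h, []⟩] =
      val ψ (g.dom ++ m ++ h.dom) (g.cod ++ m ++ h.cod)
        [⟨g.dom ++ m, h, []⟩, ⟨[], g, m ++ h.cod⟩] :=
  S.planar (.interchange g h m) (by simp) (by simp)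

theorem rotate (S : SkeinTheory n ψ) (x : Node) :
    val ψ [!x.tl, x.bl] [x.tr, !x.br] [nodeAt [] x.rot []] =
      val ψ [!x.tl, x.bl] [x.tr, !x.br]
        [cupAt [!x.tl, x.bl] x.br [], nodeAt [!x.tl] x [!x.br],
          capAt [] (!x.tl) [x.tr, !x.br]] :=
  S.planar (.rotate x) (by simp) (by simp)

theorem zigzag_left (S : SkeinTheory n ψ) (a : Bool) :
    val ψ [a] [a] [cupAt [] a [a], capAt [a] (!a) []] = val ψ [a] [a] [] :=
  S.planar (.zigzag_left a) (by simp) (by simp)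

theorem zigzag_right (S : SkeinTheory n ψ) (a : Bool) :
    val ψ [a] [a] [cupAt [a] (!a) [], capAt [] a [a]] = val ψ [a] [a] [] :=
  S.planar (.zigzag_right a) (by simp) (by simp)

/-- A minimum on the left of a node moves to its right, turning the node by a quarter turn. -/
theorem cup_rot (S : SkeinTheory n ψ) (x : Node) :
    val ψ [x.bl] [x.tl, x.tr, !x.br] [cupAt [] x.tl [x.bl], nodeAt [x.tl] x.rot []] =
      val ψ [x.bl] [x.tl, x.tr, !x.br] [cupAt [x.bl] x.br [], nodeAt [] x [!x.br]] :=
  calc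
    _ = val ψ [x.bl] [x.tl, x.tr, !x.br] [cupAt [] x.tl [x.bl], cupAt [x.tl, !x.tl, x.bl] x.br [],
          nodeAt [x.tl, !x.tl] x [!x.br], capAt [x.tl] (!x.tl) [x.tr, !x.br]] := by
      simpa using val_congr (S.rotate x) [cupAt [] x.tl [x.bl]] [] [x.tl] [] (by simp) (by simp)
    _ = val ψ [x.bl] [x.tl, x.tr, !x.br] [cupAt [x.bl] x.br [], cupAt [] x.tl [x.bl, x.br, !x.br],
          nodeAt [x.tl, !x.tl] x [!x.br], capAt [x.tl] (!x.tl) [x.tr, !x.br]] := by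
      simpa using val_congr (S.interchange (.cup x.tl) (.cup x.br) [x.bl]) []
        [nodeAt [x.tl, !x.tl] x [!x.br], capAt [x.tl] (!x.tl) [x.tr, !x.br]] [] []
        (by simp) (by simp)
    _ = val ψ [x.bl] [x.tl, x.tr, !x.br] [cupAt [x.bl] x.br [], nodeAt [] x [!x.br],
          cupAt [] x.tl [x.tl, x.tr, !x.br], capAt [x.tl] (!x.tl) [x.tr, !x.br]] := by
      simpa using val_congr (S.interchange (.cup x.tl) (.node x) []) [cupAt [x.bl] x.br []]
        [capAt [x.tl] (!x.tl) [x.tr, !x.br]] [] [!x.br] (by simp) (by simp)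
    _ = _ := by
      simpa using val_congr (S.zigzag_left x.tl) [cupAt [x.bl] x.br [], nodeAt [] x [!x.br]] []
        [] [x.tr, !x.br] (by simp) (by simp)

/-- A maximum on the right of a node moves to its left, turning the node by a quarter turn. -/
theorem rot_cap (S : SkeinTheory n ψ) (x : Node) :
    val ψ [!x.tl, x.bl, x.br] [x.tr] [nodeAt [] x.rot [x.br], capAt [x.tr] (!x.br) []] =
      val ψ [!x.tl, x.bl, x.br] [x.tr] [nodeAt [!x.tl] x [], capAt [] (!x.tl) [x.tr]] :=
  calc
    _ = val ψ [!x.tl, x.bl, x.br] [x.tr] [cupAt [!x.tl, x.bl] x.br [x.br],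
          nodeAt [!x.tl] x [!x.br, x.br], capAt [] (!x.tl) [x.tr, !x.br, x.br],
          capAt [x.tr] (!x.br) []] := by
      simpa using val_congr (S.rotate x) [] [capAt [x.tr] (!x.br) []] [] [x.br] (by simp) (by simp)
    _ = val ψ [!x.tl, x.bl, x.br] [x.tr] [cupAt [!x.tl, x.bl] x.br [x.br],
          nodeAt [!x.tl] x [!x.br, x.br], capAt [!x.tl, x.tl, x.tr] (!x.br) [],
          capAt [] (!x.tl) [x.tr]] := by
      simpa using val_congr (S.interchange (.cap (!x.tl)) (.cap (!x.br)) [x.tr])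
        [cupAt [!x.tl, x.bl] x.br [x.br], nodeAt [!x.tl] x [!x.br, x.br]] [] [] []
        (by simp) (by simp)
    _ = val ψ [!x.tl, x.bl, x.br] [x.tr] [cupAt [!x.tl, x.bl] x.br [x.br],
          capAt [!x.tl, x.bl, x.br] (!x.br) [], nodeAt [!x.tl] x [],
          capAt [] (!x.tl) [x.tr]] := by
      simpa using val_congr (S.interchange (.node x) (.cap (!x.br)) [])
        [cupAt [!x.tl, x.bl] x.br [x.br]] [capAt [] (!x.tl) [x.tr]] [!x.tl] []
        (by simp) (by simp)
    _ = _ := by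
      simpa using val_congr (S.zigzag_left x.br) [] [nodeAt [!x.tl] x [], capAt [] (!x.tl) [x.tr]]
        [!x.tl, x.bl] [] (by simp) (by simp)

/-- A vertex on top of a minimum: a loop, seen sideways. -/
theorem cup_iioo (S : SkeinTheory n ψ) (d : Bool) :
    val ψ [] [!d, d] [cupAt [] d [], iiooAt [] d (!d) []] =
      qint (n - 1) • val ψ [] [!d, d] [cupAt [] (!d) []] :=
  calc
    _ = val ψ [] [!d, d] [cupAt [] d [], cupAt [d, !d] (!d) [], iiooAt [d] (!d) (!d) [d],
          capAt [] d [!d, d]] := by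
      simpa using val_congr (S.rotate (.vertex (.iioo (!d) (!d)))) [cupAt [] d []] [] [] []
        (by simp) (by simp)
    _ = val ψ [] [!d, d] [cupAt [] (!d) [], cupAt [] d [!d, d], iiooAt [d] (!d) (!d) [d],
          capAt [] d [!d, d]] := by
      simpa using val_congr (S.interchange (.cup d) (.cup (!d)) []) []
        [iiooAt [d] (!d) (!d) [d], capAt [] d [!d, d]] [] [] (by simp) (by simp)
    _ = _ := by
      simpa using val_congr_smul (S.loop_left (!d)) [cupAt [] (!d) []] [] [] [d] (by simp) (by simp)

/-- A maximum on top of a vertex: a loop, seen sideways. -/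
theorem iioo_cap (S : SkeinTheory n ψ) (d : Bool) :
    val ψ [!d, d] [] [iiooAt [] (!d) d [], capAt [] d []] =
      qint (n - 1) • val ψ [!d, d] [] [capAt [] (!d) []] :=
  calc
    _ = val ψ [!d, d] [] [cupAt [!d, d] d [], iiooAt [!d] d d [!d],
          capAt [] (!d) [d, !d], capAt [] d []] := by
      simpa using val_congr (S.rotate (.vertex (.iioo d d))) [] [capAt [] d []] [] []
        (by simp) (by simp)
    _ = val ψ [!d, d] [] [cupAt [!d, d] d [], iiooAt [!d] d d [!d],
          capAt [!d, d] d [], capAt [] (!d) []] := by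
      simpa using val_congr (S.interchange (.cap (!d)) (.cap d) [])
        [cupAt [!d, d] d [], iiooAt [!d] d d [!d]] [] [] [] (by simp) (by simp)
    _ = _ := by
      simpa using val_congr_smul (S.loop_right d) [] [capAt [] (!d) []] [!d] [] (by simp) (by simp)

end SkeinTheory

/-! ### Quantum integers -/

theorem T_one_mul_T_neg_one : (T 1 * T (-1) : ℤ[T;T⁻¹]) = 1 := by
  rw [← T_add]; simp

theorem T_mul_T_neg (m : ℤ) : (T m * T (-m) : ℤ[T;T⁻¹]) = 1 := by
  rw [← T_add]; simp

theorem T_one_sub_ne_zero : (T 1 - T (-1) : ℤ[T;T⁻¹]) ≠ 0 := by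
  intro h
  have := congrArg (fun p : ℤ[T;T⁻¹] => p.coeff 1) h
  simp at this

theorem T_sub_one (m : ℤ) : (T (m - 1) : ℤ[T;T⁻¹]) = T m * T (-1) := by
  rw [sub_eq_add_neg, T_add]

/-- The polynomial `q ^ (s n) (q ^ (-s) [n] - [n - 1])` by which a curl multiplies a strand. -/
theorem curl_eq_one (n s : ℤ) (hs : s = 1 ∨ s = -1) :
    (T (s * n) * (T (-s) * qint n - qint (n - 1)) : ℤ[T;T⁻¹]) = 1 := by
  apply mul_right_cancel₀ T_one_sub_ne_zero
  have h1 := qint_mul n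
  have h2 := qint_mul (n - 1)
  have h3 := T_one_mul_T_neg_one
  have h4 := T_mul_T_neg n
  rw [T_sub_one, show -(n - 1) = -n + 1 by ring, T_add] at h2
  rcases hs with rfl | rfl <;> simp only [one_mul, neg_mul, neg_neg] <;> grind

theorem qint_two : qint 2 = T 1 + T (-1) := by
  apply mul_right_cancel₀ T_one_sub_ne_zero
  rw [qint_mul, show (2 : ℤ) = 1 + 1 by rfl, neg_add, T_add, T_add]
  ring

theorem qint_recurrence (n : ℤ) : qint n + qint (n - 2) = (T 1 + T (-1)) * qint (n - 1) := by
  apply mul_right_cancel₀ T_one_sub_ne_zero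
  have h1 := qint_mul n
  have h2 := qint_mul (n - 1)
  have h3 := T_one_mul_T_neg_one
  have h4 := T_mul_T_neg n
  have h5 := qint_mul (n - 2)
  rw [T_sub_one, show -(n - 1) = -n + 1 by ring, T_add] at h2
  rw [show n - 2 = n + (-1) + (-1) by ring, show -(n + (-1) + (-1)) = -n + 1 + 1 by ring,
    T_add, T_add, T_add, T_add] at h5
  rw [show n - 2 = n + (-1) + (-1) by ring]
  grind

/-! ### Signs of crossings and smoothings -/

theorem crossingSign_eq (o a b : Bool) : crossingSign o a b = 1 ∨ crossingSign o a b = -1 := by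
  revert o a b; decide

theorem crossingSign_not (o a b : Bool) : crossingSign (!o) a b = -crossingSign o a b := by
  revert o a b; decide

theorem crossingSign_comm (o a b : Bool) : crossingSign o b a = crossingSign o a b := by
  revert o a b; decide

@[simp] theorem smoothing_self (a : Bool) : smoothing a a = [] := by simp [smoothing]

@[simp] theorem smoothing_not (a : Bool) :
    smoothing a (!a) = [capAt [] a [], cupAt [] (!a) []] := by
  simp [smoothing]

@[simp] theorem smoothing_not' (a : Bool) :
    smoothing (!a) a = [capAt [] (!a) [], cupAt [] a []] := by
  simp [smoothing]

theorem isTangle_smoothing (a b : Bool) : IsTangle [a, b] (smoothing a b) [b, a] := by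
  cases a <;> cases b <;> simp [smoothing]

namespace SkeinTheory

/-- Resolution of a crossing inside a larger picture. -/
theorem crossing_insert (S : SkeinTheory n ψ) (o a b : Bool) (p q : Word) (L R : List Bool)
    {a' b' : List Bool} (hp : IsTangle a' p (L ++ [a, b] ++ R))
    (hq : IsTangle (L ++ [b, a] ++ R) q b') :
    val ψ a' b' (p ++ [crossAt L o a b R] ++ q) =
      (T (crossingSign o a b * n) : ℤ[T;T⁻¹]) •
        ((T (-crossingSign o a b) : ℤ[T;T⁻¹]) •
            val ψ a' b' (p ++ (smoothing a b).map (Slice.whisker L R) ++ q) -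
          val ψ a' b' (p ++ [iiooAt L a b R] ++ q)) := by
  have := val_congr_add (S.crossing o a b) p q L R hp hq
  rw [mul_sub, mul_one, sub_eq_add_neg, T_add] at this
  simp only [Slice.whisker, List.map_cons, List.map_nil, List.append_nil, List.nil_append] at this
  rw [this]
  module

/-- Resolution of two consecutive crossings. -/
theorem expand_two (S : SkeinTheory n ψ) {A B : List Bool} (L₁ R₁ L₂ R₂ : List Bool)
    (o₁ a₁ b₁ o₂ a₂ b₂ : Bool)
    (h : IsTangle A [crossAt L₁ o₁ a₁ b₁ R₁, crossAt L₂ o₂ a₂ b₂ R₂] B) :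
    val ψ A B [crossAt L₁ o₁ a₁ b₁ R₁, crossAt L₂ o₂ a₂ b₂ R₂] =
      (T (crossingSign o₁ a₁ b₁ * n) * T (crossingSign o₂ a₂ b₂ * n) : ℤ[T;T⁻¹]) •
      ((T (-crossingSign o₁ a₁ b₁) * T (-crossingSign o₂ a₂ b₂) : ℤ[T;T⁻¹]) •
          val ψ A B ((smoothing a₁ b₁).map (Slice.whisker L₁ R₁) ++
            (smoothing a₂ b₂).map (Slice.whisker L₂ R₂))
        - (T (-crossingSign o₁ a₁ b₁) : ℤ[T;T⁻¹]) •
          val ψ A B ((smoothing a₁ b₁).map (Slice.whisker L₁ R₁) ++ [iiooAt L₂ a₂ b₂ R₂])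
        - (T (-crossingSign o₂ a₂ b₂) : ℤ[T;T⁻¹]) •
          val ψ A B ([iiooAt L₁ a₁ b₁ R₁] ++ (smoothing a₂ b₂).map (Slice.whisker L₂ R₂))
        + val ψ A B [iiooAt L₁ a₁ b₁ R₁, iiooAt L₂ a₂ b₂ R₂]) := by
  obtain ⟨h₁, h₂, h₃⟩ : A = L₁ ++ [a₁, b₁] ++ R₁ ∧ L₁ ++ [b₁, a₁] ++ R₁ = L₂ ++ [a₂, b₂] ++ R₂ ∧
    L₂ ++ [b₂, a₂] ++ R₂ = B := by simpa using h
  have s₁ := (isTangle_smoothing a₁ b₁).whisker L₁ R₁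
  have e := S.crossing_insert o₁ a₁ b₁ [] [crossAt L₂ o₂ a₂ b₂ R₂] L₁ R₁ (a' := A) (b' := B)
    (by simp [h₁]) (by simpa [h₃] using h₂)
  have e₁ := S.crossing_insert o₂ a₂ b₂ ((smoothing a₁ b₁).map (Slice.whisker L₁ R₁)) [] L₂ R₂
    (a' := A) (b' := B) (by rw [h₁, ← h₂]; exact s₁) (by simp [h₃])
  have e₂ := S.crossing_insert o₂ a₂ b₂ [iiooAt L₁ a₁ b₁ R₁] [] L₂ R₂
    (a' := A) (b' := B) (by simp [h₁, ← h₂]) (by simp [h₃])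
  simp only [List.nil_append, List.append_nil, List.cons_append] at e e₁ e₂ ⊢
  rw [e, e₁, e₂]
  module

/-- Resolution of three consecutive crossings. -/
theorem expand_three (S : SkeinTheory n ψ) {A B : List Bool} (L₁ R₁ L₂ R₂ L₃ R₃ : List Bool)
    (o₁ a₁ b₁ o₂ a₂ b₂ o₃ a₃ b₃ : Bool)
    (h : IsTangle A [crossAt L₁ o₁ a₁ b₁ R₁, crossAt L₂ o₂ a₂ b₂ R₂, crossAt L₃ o₃ a₃ b₃ R₃] B) :
    val ψ A B [crossAt L₁ o₁ a₁ b₁ R₁, crossAt L₂ o₂ a₂ b₂ R₂, crossAt L₃ o₃ a₃ b₃ R₃] =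
      (T (crossingSign o₁ a₁ b₁ * n) * T (crossingSign o₂ a₂ b₂ * n) *
        T (crossingSign o₃ a₃ b₃ * n) : ℤ[T;T⁻¹]) •
      ((T (-crossingSign o₁ a₁ b₁) * T (-crossingSign o₂ a₂ b₂) *
            T (-crossingSign o₃ a₃ b₃) : ℤ[T;T⁻¹]) •
          val ψ A B ((smoothing a₁ b₁).map (Slice.whisker L₁ R₁) ++
            (smoothing a₂ b₂).map (Slice.whisker L₂ R₂) ++
            (smoothing a₃ b₃).map (Slice.whisker L₃ R₃))
        - (T (-crossingSign o₁ a₁ b₁) * T (-crossingSign o₂ a₂ b₂) : ℤ[T;T⁻¹]) •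
          val ψ A B ((smoothing a₁ b₁).map (Slice.whisker L₁ R₁) ++
            (smoothing a₂ b₂).map (Slice.whisker L₂ R₂) ++ [iiooAt L₃ a₃ b₃ R₃])
        - (T (-crossingSign o₁ a₁ b₁) * T (-crossingSign o₃ a₃ b₃) : ℤ[T;T⁻¹]) •
          val ψ A B ((smoothing a₁ b₁).map (Slice.whisker L₁ R₁) ++ [iiooAt L₂ a₂ b₂ R₂] ++
            (smoothing a₃ b₃).map (Slice.whisker L₃ R₃))
        - (T (-crossingSign o₂ a₂ b₂) * T (-crossingSign o₃ a₃ b₃) : ℤ[T;T⁻¹]) •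
          val ψ A B ([iiooAt L₁ a₁ b₁ R₁] ++ (smoothing a₂ b₂).map (Slice.whisker L₂ R₂) ++
            (smoothing a₃ b₃).map (Slice.whisker L₃ R₃))
        + (T (-crossingSign o₁ a₁ b₁) : ℤ[T;T⁻¹]) •
          val ψ A B ((smoothing a₁ b₁).map (Slice.whisker L₁ R₁) ++
            [iiooAt L₂ a₂ b₂ R₂, iiooAt L₃ a₃ b₃ R₃])
        + (T (-crossingSign o₂ a₂ b₂) : ℤ[T;T⁻¹]) •
          val ψ A B ([iiooAt L₁ a₁ b₁ R₁] ++ (smoothing a₂ b₂).map (Slice.whisker L₂ R₂) ++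
            [iiooAt L₃ a₃ b₃ R₃])
        + (T (-crossingSign o₃ a₃ b₃) : ℤ[T;T⁻¹]) •
          val ψ A B ([iiooAt L₁ a₁ b₁ R₁, iiooAt L₂ a₂ b₂ R₂] ++
            (smoothing a₃ b₃).map (Slice.whisker L₃ R₃))
        - val ψ A B [iiooAt L₁ a₁ b₁ R₁, iiooAt L₂ a₂ b₂ R₂, iiooAt L₃ a₃ b₃ R₃]) := by
  obtain ⟨h₁, h₂, h₃, h₄⟩ : A = L₁ ++ [a₁, b₁] ++ R₁ ∧
    L₁ ++ [b₁, a₁] ++ R₁ = L₂ ++ [a₂, b₂] ++ R₂ ∧ L₂ ++ [b₂, a₂] ++ R₂ = L₃ ++ [a₃, b₃] ++ R₃ ∧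
    L₃ ++ [b₃, a₃] ++ R₃ = B := by simpa using h
  have s₁ : IsTangle A _ _ := h₁ ▸ (isTangle_smoothing a₁ b₁).whisker L₁ R₁
  have s₂ := (isTangle_smoothing a₂ b₂).whisker L₂ R₂
  rw [h₂] at s₁
  rw [h₃] at s₂
  have v₁ : IsTangle A [iiooAt L₁ a₁ b₁ R₁] (L₂ ++ [a₂, b₂] ++ R₂) := by simp [h₁, ← h₂]
  have v₂ : IsTangle (L₂ ++ [a₂, b₂] ++ R₂) [iiooAt L₂ a₂ b₂ R₂] (L₃ ++ [a₃, b₃] ++ R₃) := by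
    simp [← h₃]
  have c₃ : IsTangle (L₂ ++ [b₂, a₂] ++ R₂) [crossAt L₃ o₃ a₃ b₃ R₃] B := by simp [h₃, ← h₄]
  have e := S.crossing_insert o₁ a₁ b₁ [] [crossAt L₂ o₂ a₂ b₂ R₂, crossAt L₃ o₃ a₃ b₃ R₃] L₁ R₁
    (a' := A) (b' := B) (by simp [h₁]) ⟨h₂, h₃, h₄⟩
  have e₁ := S.crossing_insert o₂ a₂ b₂ _ [crossAt L₃ o₃ a₃ b₃ R₃] L₂ R₂ s₁ c₃
  have e₂ := S.crossing_insert o₂ a₂ b₂ _ [crossAt L₃ o₃ a₃ b₃ R₃] L₂ R₂ v₁ c₃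
  have e₁₁ := S.crossing_insert o₃ a₃ b₃ _ [] L₃ R₃ (s₁.append s₂) (b' := B) (by simp [h₄])
  have e₁₂ := S.crossing_insert o₃ a₃ b₃ _ [] L₃ R₃ (s₁.append v₂) (b' := B) (by simp [h₄])
  have e₂₁ := S.crossing_insert o₃ a₃ b₃ _ [] L₃ R₃ (v₁.append s₂) (b' := B) (by simp [h₄])
  have e₂₂ := S.crossing_insert o₃ a₃ b₃ _ [] L₃ R₃ (v₁.append v₂) (b' := B) (by simp [h₄])
  simp only [List.nil_append, List.append_nil, List.cons_append, List.append_assoc]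
    at e e₁ e₂ e₁₁ e₁₂ e₂₁ e₂₂ ⊢
  rw [e, e₁, e₂, e₁₁, e₁₂, e₂₁, e₂₂]
  module

/-! ### The moves `R1` and `R2` -/

theorem r1_right (S : SkeinTheory n ψ) (o a : Bool) :
    val ψ [a] [a] [cupAt [a] a [], crossAt [] o a a [!a], capAt [a] a []] = val ψ [a] [a] [] := by
  have e := S.crossing_insert o a a [cupAt [a] a []] [capAt [a] a []] [] [!a] (a' := [a])
    (b' := [a]) (by simp) (by simp)
  have c := val_congr_smul (S.circle a) [] [] [a] [] (a' := [a]) (b' := [a]) (by simp) (by simp)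
  simp at e c
  rw [e, c, S.loop_right, smul_smul, ← sub_smul, smul_smul,
    curl_eq_one n _ (crossingSign_eq o a a), one_smul]

theorem r1_left (S : SkeinTheory n ψ) (o a : Bool) :
    val ψ [a] [a] [cupAt [] (!a) [a], crossAt [!a] o a a [], capAt [] (!a) [a]] =
      val ψ [a] [a] [] := by
  have e := S.crossing_insert o a a [cupAt [] (!a) [a]] [capAt [] (!a) [a]] [!a] [] (a' := [a])
    (b' := [a]) (by simp) (by simp)
  have c := val_congr_smul (S.circle (!a)) [] [] [] [a] (a' := [a]) (b' := [a]) (by simp) (by simp)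
  simp at e c
  rw [e, c, S.loop_left, smul_smul, ← sub_smul, smul_smul,
    curl_eq_one n _ (crossingSign_eq o a a), one_smul]

/-- A curl at a minimum. -/
theorem cup_cross (S : SkeinTheory n ψ) (o d : Bool) :
    val ψ [] [!d, d] [cupAt [] d [], crossAt [] o d (!d) []] =
      val ψ [] [!d, d] [cupAt [] (!d) []] := by
  have e := S.crossing_insert o d (!d) [cupAt [] d []] [] [] [] (a' := []) (b' := [!d, d])
    (by simp) (by simp)
  have c := val_congr_smul (S.circle d) [] [cupAt [] (!d) []] [] [] (a' := []) (b' := [!d, d])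
    (by simp) (by simp)
  simp at e c
  rw [e, c, S.cup_iioo, smul_smul, ← sub_smul, smul_smul,
    curl_eq_one n _ (crossingSign_eq _ _ _), one_smul]

/-- A curl at a maximum. -/
theorem cross_cap (S : SkeinTheory n ψ) (o d : Bool) :
    val ψ [!d, d] [] [crossAt [] o (!d) d [], capAt [] d []] =
      val ψ [!d, d] [] [capAt [] (!d) []] := by
  have e := S.crossing_insert o (!d) d [] [capAt [] d []] [] [] (a' := [!d, d]) (b' := [])
    (by simp) (by simp)
  have c := val_congr_smul (S.circle d) [capAt [] (!d) []] [] [] [] (a' := [!d, d]) (b' := [])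
    (by simp) (by simp)
  simp at e c
  rw [e, c, S.iioo_cap, smul_smul, ← sub_smul, smul_smul,
    curl_eq_one n _ (crossingSign_eq _ _ _), one_smul]

theorem r2 (S : SkeinTheory n ψ) (o a b : Bool) :
    val ψ [a, b] [a, b] [crossAt [] o a b [], crossAt [] (!o) b a []] = val ψ [a, b] [a, b] [] := by
  rw [S.expand_two [] [] [] [] o a b (!o) b a (by simp), crossingSign_not, crossingSign_comm o a b]
  have hT : (T (crossingSign o a b * n) * T (-crossingSign o a b * n) : ℤ[T;T⁻¹]) = 1 := by
    rw [neg_mul, T_mul_T_neg]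
  have hT' : (T (-crossingSign o a b) * T (- -crossingSign o a b) : ℤ[T;T⁻¹]) = 1 := T_mul_T_neg _
  have hq : (T (-crossingSign o a b) + T (- -crossingSign o a b) : ℤ[T;T⁻¹]) = T 1 + T (-1) := by
    rcases crossingSign_eq o a b with h | h <;> simp [h, add_comm]
  rw [hT, one_smul, hT']
  -- From here on only `x + y = [2]` matters.
  generalize (T (-crossingSign o a b) : ℤ[T;T⁻¹]) = x at *
  generalize (T (- -crossingSign o a b) : ℤ[T;T⁻¹]) = y at *
  by_cases hab : b = a
  · subst hab
    simp only [smoothing_self, List.map_nil, List.append_nil, List.nil_append, S.bigon_parallel,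
      qint_two, ← hq]
    module
  · obtain rfl : b = !a := Bool.eq_not.2 hab
    have c := val_congr_smul (S.circle (!a)) [capAt [] a []] [cupAt [] a []] [] []
      (a' := [a, !a]) (b' := [a, !a]) (by simp) (by simp)
    have l := val_congr_smul (S.cup_iioo (!a)) [capAt [] a []] [] [] []
      (a' := [a, !a]) (b' := [a, !a]) (by simp) (by simp)
    have r := val_congr_smul (S.iioo_cap (!a)) [] [cupAt [] a []] [] []
      (a' := [a, !a]) (b' := [a, !a]) (by simp) (by simp)
    simp at c l r
    simp [c, l, r, S.bigon_antiparallel]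
    have h := qint_recurrence n
    rw [← hq] at h
    rw [eq_sub_of_add_eq h]
    module

/-! ### A strand sliding past a maximum or a minimum -/

/-- Turning one of the two crossings by a quarter turn gives the move `R2` below the maximum. -/
theorem cap_slide (S : SkeinTheory n ψ) (o d e : Bool) :
    val ψ [d, !d, e] [e] [capAt [] d [e]] =
      val ψ [d, !d, e] [e] [crossAt [d] o (!d) e [], crossAt [] o d e [!d], capAt [e] d []] := by
  have h₁ := val_congr (S.rot_cap (.crossing (!o) e (!d))) [crossAt [d] o (!d) e []] [] [] []
    (a' := [d, !d, e]) (b' := [e]) (by simp) (by simp)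
  have h₂ := val_congr (S.r2 o (!d) e) [] [capAt [] d [e]] [d] []
    (a' := [d, !d, e]) (b' := [e]) (by simp) (by simp)
  simp at h₁ h₂
  rw [h₁, h₂]

/-- Turning one of the two crossings by a quarter turn gives the move `R2` above the minimum. -/
theorem cup_slide (S : SkeinTheory n ψ) (o d e : Bool) :
    val ψ [e] [e, d, !d] [cupAt [] d [e], crossAt [d] o (!d) e [], crossAt [] o d e [!d]] =
      val ψ [e] [e, d, !d] [cupAt [e] d []] := by
  have h₁ := val_congr (S.cup_rot (.crossing (!o) e d)) [] [crossAt [] o d e [!d]] [] []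
    (a' := [e]) (b' := [e, d, !d]) (by simp) (by simp)
  have h₂ := val_congr (S.r2 (!o) e d) [cupAt [e] d []] [] [] [!d]
    (a' := [e]) (b' := [e, d, !d]) (by simp) (by simp)
  simp at h₁ h₂
  rw [h₁, h₂]

/-! ### The move `R3` -/

/-- The move `R3` for strands oriented `a`, `b`, `c`. -/
def IsR3 (ψ : Word → M) (a b c : Bool) : Prop :=
  ∀ o₁₂ o₁₃ o₂₃ : Bool, (o₁₂ = o₂₃ → o₁₃ = o₁₂) →
    val ψ [a, b, c] [c, b, a]
        [crossAt [] o₁₂ a b [c], crossAt [b] o₁₃ a c [], crossAt [] o₂₃ b c [a]] =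
      val ψ [a, b, c] [c, b, a]
        [crossAt [a] o₂₃ b c [], crossAt [] o₁₃ a c [b], crossAt [c] o₁₂ a b []]

/-- The coefficients of a single vertex on the two sides of `R3` differ by `1`. -/
theorem r3_vertex_coeff {o₁₂ o₁₃ o₂₃ : Bool} (h : o₁₂ = o₂₃ → o₁₃ = o₁₂) (a : Bool) :
    (T (-crossingSign o₁₃ a a) * qint 2 + T (-crossingSign o₁₂ a a) * T (-crossingSign o₂₃ a a) -
      T (-crossingSign o₁₂ a a) * T (-crossingSign o₁₃ a a) -
      T (-crossingSign o₁₃ a a) * T (-crossingSign o₂₃ a a) : ℤ[T;T⁻¹]) = 1 := by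
  have h3 := T_one_mul_T_neg_one
  have ht : crossingSign true a a = 1 := by simp [crossingSign]
  have hf : crossingSign false a a = -1 := by simp [crossingSign]
  rw [qint_two]
  cases o₁₂ <;> cases o₁₃ <;> cases o₂₃ <;> simp only [ht, hf, neg_neg] <;> grind

theorem r3_parallel (S : SkeinTheory n ψ) (a : Bool) : IsR3 ψ a a a := by
  intro o₁₂ o₁₃ o₂₃ h
  have hc := r3_vertex_coeff h a
  have b₁ := val_congr_smul (S.bigon_parallel a) [] [] [] [a]
    (a' := [a, a, a]) (b' := [a, a, a]) (by simp) (by simp)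
  have b₂ := val_congr_smul (S.bigon_parallel a) [] [] [a] []
    (a' := [a, a, a]) (b' := [a, a, a]) (by simp) (by simp)
  have t := S.triangle_acyclic a
  simp at b₁ b₂
  rw [S.expand_three [] [a] [a] [] [] [a] _ _ _ _ _ _ _ _ _ (by simp),
    S.expand_three [a] [] [] [a] [a] [] _ _ _ _ _ _ _ _ _ (by simp)]
  simp only [smoothing_self, List.map_nil, List.append_nil, List.nil_append, List.cons_append,
    b₁, b₂, eq_sub_of_add_eq t]
  generalize (T (-crossingSign o₁₂ a a) : ℤ[T;T⁻¹]) = x at *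
  generalize (T (-crossingSign o₁₃ a a) : ℤ[T;T⁻¹]) = y at *
  generalize (T (-crossingSign o₂₃ a a) : ℤ[T;T⁻¹]) = z at *
  match_scalars <;> grind

/-- Two strands `a`, `b` cross a strand `!c`; equivalently, a strand `c` that enters through a
minimum on the right and leaves through a maximum on the left crosses them. -/
theorem double_turn (S : SkeinTheory n ψ) (o o' a b c : Bool) :
    val ψ [!c, a, b] [a, b, !c] [crossAt [] o (!c) a [b], crossAt [a] o' (!c) b []] =
      val ψ [!c, a, b] [a, b, !c] [cupAt [!c, a, b] c [], crossAt [!c, a] (!o') b c [!c],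
        crossAt [!c] (!o) a c [b, !c], capAt [] (!c) [a, b, !c]] :=
  calc
    _ = val ψ [!c, a, b] [a, b, !c] [cupAt [!c, a] c [b], crossAt [!c] (!o) a c [!c, b],
          capAt [] (!c) [a, !c, b], crossAt [a] o' (!c) b []] := by
      simpa using val_congr (S.rotate (.crossing (!o) a c)) [] [crossAt [a] o' (!c) b []] [] [b]
        (by simp) (by simp)
    _ = val ψ [!c, a, b] [a, b, !c] [cupAt [!c, a] c [b], crossAt [!c] (!o) a c [!c, b],
          crossAt [!c, c, a] o' (!c) b [], capAt [] (!c) [a, b, !c]] := by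
      simpa using val_congr (S.interchange (.cap (!c)) (.node (.crossing o' (!c) b)) [a])
        [cupAt [!c, a] c [b], crossAt [!c] (!o) a c [!c, b]] [] [] [] (by simp) (by simp)
    _ = val ψ [!c, a, b] [a, b, !c] [cupAt [!c, a] c [b], crossAt [!c, a, c] o' (!c) b [],
          crossAt [!c] (!o) a c [b, !c], capAt [] (!c) [a, b, !c]] := by
      simpa using val_congr (S.interchange (.node (.crossing (!o) a c))
        (.node (.crossing o' (!c) b)) [])
        [cupAt [!c, a] c [b]] [capAt [] (!c) [a, b, !c]] [!c] [] (by simp) (by simp)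
    _ = _ := by
      simpa using val_congr (S.cup_rot (.crossing (!o') b c)) []
        [crossAt [!c] (!o) a c [b, !c], capAt [] (!c) [a, b, !c]] [!c, a] [] (by simp) (by simp)

/-- Rotating the picture of `R3` by a sixth of a turn exchanges its two sides. -/
theorem r3_rotate (S : SkeinTheory n ψ) {a b c : Bool} (h : IsR3 ψ a b c) :
    IsR3 ψ (!c) a b := fun o₁₂ o₁₃ o₂₃ ho =>
  calc
    _ = val ψ [!c, a, b] [b, a, !c] [cupAt [!c, a, b] c [], crossAt [!c, a] (!o₁₃) b c [!c],
          crossAt [!c] (!o₁₂) a c [b, !c], capAt [] (!c) [a, b, !c],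
          crossAt [] o₂₃ a b [!c]] := by
      simpa using val_congr (S.double_turn o₁₂ o₁₃ a b c) [] [crossAt [] o₂₃ a b [!c]] [] []
        (by simp) (by simp)
    _ = val ψ [!c, a, b] [b, a, !c] [cupAt [!c, a, b] c [], crossAt [!c, a] (!o₁₃) b c [!c],
          crossAt [!c] (!o₁₂) a c [b, !c], crossAt [!c, c] o₂₃ a b [!c],
          capAt [] (!c) [b, a, !c]] := by
      simpa using val_congr (S.interchange (.cap (!c)) (.node (.crossing o₂₃ a b)) [])
        [cupAt [!c, a, b] c [], crossAt [!c, a] (!o₁₃) b c [!c],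
          crossAt [!c] (!o₁₂) a c [b, !c]] [] [] [!c] (by simp) (by simp)
    _ = val ψ [!c, a, b] [b, a, !c] [cupAt [!c, a, b] c [], crossAt [!c] o₂₃ a b [c, !c],
          crossAt [!c, b] (!o₁₂) a c [!c], crossAt [!c] (!o₁₃) b c [a, !c],
          capAt [] (!c) [b, a, !c]] := by
      simpa using (val_congr (h o₂₃ (!o₁₂) (!o₁₃) (by revert o₁₂ o₁₃ o₂₃; decide))
        [cupAt [!c, a, b] c []] [capAt [] (!c) [b, a, !c]] [!c] [!c] (by simp) (by simp)).symm
    _ = val ψ [!c, a, b] [b, a, !c] [crossAt [!c] o₂₃ a b [], cupAt [!c, b, a] c [],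
          crossAt [!c, b] (!o₁₂) a c [!c], crossAt [!c] (!o₁₃) b c [a, !c],
          capAt [] (!c) [b, a, !c]] := by
      simpa using (val_congr (S.interchange (.node (.crossing o₂₃ a b)) (.cup c) [])
        [] [crossAt [!c, b] (!o₁₂) a c [!c], crossAt [!c] (!o₁₃) b c [a, !c],
          capAt [] (!c) [b, a, !c]] [!c] [] (by simp) (by simp)).symm
    _ = _ := by
      simpa using (val_congr (S.double_turn o₁₃ o₁₂ b a c) [crossAt [!c] o₂₃ a b []] [] [] []
        (by simp) (by simp)).symm

/-- Conjugation by the crossing of the first two strands. -/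
theorem r3_swap_left (S : SkeinTheory n ψ) {a b c : Bool} (h : IsR3 ψ b a c) : IsR3 ψ a b c :=
  fun o₁₂ o₁₃ o₂₃ ho =>
  calc
    _ = val ψ [a, b, c] [c, b, a] [crossAt [] o₁₂ a b [c], crossAt [b] o₁₃ a c [],
          crossAt [] o₂₃ b c [a], crossAt [c] (!o₁₂) b a [], crossAt [c] o₁₂ a b []] := by
      simpa using (val_congr (S.r2 (!o₁₂) b a) [crossAt [] o₁₂ a b [c], crossAt [b] o₁₃ a c [],
        crossAt [] o₂₃ b c [a]] [] [c] [] (by simp) (by simp)).symm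
    _ = val ψ [a, b, c] [c, b, a] [crossAt [] o₁₂ a b [c], crossAt [] (!o₁₂) b a [c],
          crossAt [a] o₂₃ b c [], crossAt [] o₁₃ a c [b], crossAt [c] o₁₂ a b []] := by
      simpa using (val_congr (h (!o₁₂) o₂₃ o₁₃ (by revert o₁₂ o₁₃ o₂₃; decide))
        [crossAt [] o₁₂ a b [c]] [crossAt [c] o₁₂ a b []] [] [] (by simp) (by simp)).symm
    _ = _ := by
      simpa using val_congr (S.r2 o₁₂ a b) [] [crossAt [a] o₂₃ b c [], crossAt [] o₁₃ a c [b],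
        crossAt [c] o₁₂ a b []] [] [c] (by simp) (by simp)

/-- Conjugation by the crossing of the last two strands. -/
theorem r3_swap_right (S : SkeinTheory n ψ) {a b c : Bool} (h : IsR3 ψ a c b) : IsR3 ψ a b c :=
  fun o₁₂ o₁₃ o₂₃ ho =>
  calc
    _ = val ψ [a, b, c] [c, b, a] [crossAt [a] o₂₃ b c [], crossAt [a] (!o₂₃) c b [],
          crossAt [] o₁₂ a b [c], crossAt [b] o₁₃ a c [], crossAt [] o₂₃ b c [a]] := by
      simpa using (val_congr (S.r2 o₂₃ b c) [] [crossAt [] o₁₂ a b [c], crossAt [b] o₁₃ a c [],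
        crossAt [] o₂₃ b c [a]] [a] [] (by simp) (by simp)).symm
    _ = val ψ [a, b, c] [c, b, a] [crossAt [a] o₂₃ b c [], crossAt [] o₁₃ a c [b],
          crossAt [c] o₁₂ a b [], crossAt [] (!o₂₃) c b [a], crossAt [] o₂₃ b c [a]] := by
      simpa using (val_congr (h o₁₃ o₁₂ (!o₂₃) (by revert o₁₂ o₁₃ o₂₃; decide))
        [crossAt [a] o₂₃ b c []] [crossAt [] o₂₃ b c [a]] [] [] (by simp) (by simp)).symm
    _ = _ := by
      simpa using val_congr (S.r2 (!o₂₃) c b) [crossAt [a] o₂₃ b c [], crossAt [] o₁₃ a c [b],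
        crossAt [c] o₁₂ a b []] [] [] [a] (by simp) (by simp)

theorem r3 (S : SkeinTheory n ψ) (a b c : Bool) : IsR3 ψ a b c := by
  -- The orientations with one strand against the two others, which is moved from left to right.
  have h₁ : ∀ a, IsR3 ψ (!a) a a := fun a => S.r3_rotate (S.r3_parallel a)
  have h₂ : ∀ a, IsR3 ψ a (!a) a := fun a => S.r3_swap_left (h₁ a)
  have h₃ : ∀ a, IsR3 ψ a a (!a) := fun a => S.r3_swap_right (h₂ a)
  match a, b, c with
  | true, true, true => exact S.r3_parallel _
  | false, false, false => exact S.r3_parallel _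
  | false, true, true => exact h₁ true
  | true, false, false => exact h₁ false
  | true, false, true => exact h₂ true
  | false, true, false => exact h₂ false
  | true, true, false => exact h₃ true
  | false, false, true => exact h₃ false

/-! ### The moves `R4` and `R5` -/

/-- A vertex as a combination of a smoothing and a crossing. -/
theorem iioo_insert (S : SkeinTheory n ψ) (o a b : Bool) (p q : Word) (L R : List Bool)
    {a' b' : List Bool} (hp : IsTangle a' p (L ++ [a, b] ++ R))
    (hq : IsTangle (L ++ [b, a] ++ R) q b') :
    val ψ a' b' (p ++ [iiooAt L a b R] ++ q) =
      (T (-crossingSign o a b) : ℤ[T;T⁻¹]) •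
          val ψ a' b' (p ++ (smoothing a b).map (Slice.whisker L R) ++ q) -
        (T (-(crossingSign o a b * n)) : ℤ[T;T⁻¹]) •
          val ψ a' b' (p ++ [crossAt L o a b R] ++ q) := by
  rw [S.crossing_insert o a b p q L R hp hq, smul_smul, mul_comm, T_mul_T_neg, one_smul,
    sub_sub_cancel]

theorem smoothing_slide (S : SkeinTheory n ψ) (o a b e : Bool) :
    val ψ [a, b, e] [e, b, a] ((smoothing a b).map (Slice.whisker [] [e]) ++
        [crossAt [b] o a e [], crossAt [] o b e [a]]) =
      val ψ [a, b, e] [e, b, a] ([crossAt [a] o b e [], crossAt [] o a e [b]] ++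
        (smoothing a b).map (Slice.whisker [e] [])) := by
  by_cases hab : b = a
  · subst hab
    simp
  · obtain rfl : b = !a := Bool.eq_not.2 hab
    have h₁ := val_congr (S.cup_slide o (!a) e) [capAt [] a [e]] [] [] []
      (a' := [a, !a, e]) (b' := [e, !a, a]) (by simp) (by simp)
    have h₂ := val_congr (S.cap_slide o a e) [] [cupAt [e] (!a) []] [] []
      (a' := [a, !a, e]) (b' := [e, !a, a]) (by simp) (by simp)
    simp at h₁ h₂
    simp [h₁, h₂]

theorem r4 (S : SkeinTheory n ψ) (v : Vertex) (o e : Bool) :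
    val ψ [(Node.vertex v).bl, (Node.vertex v).br, e] [e, (Node.vertex v).tl, (Node.vertex v).tr]
        [vertexAt [] v [e], crossAt [(Node.vertex v).tl] o (Node.vertex v).tr e [],
          crossAt [] o (Node.vertex v).tl e [(Node.vertex v).tr]] =
      val ψ [(Node.vertex v).bl, (Node.vertex v).br, e] [e, (Node.vertex v).tl, (Node.vertex v).tr]
        [crossAt [(Node.vertex v).bl] o (Node.vertex v).br e [],
          crossAt [] o (Node.vertex v).bl e [(Node.vertex v).br], vertexAt [e] v []] := by
  cases v with
  | iioo a b =>
    have h₁ := S.iioo_insert o a b [] [crossAt [b] o a e [], crossAt [] o b e [a]] [] [e]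
      (a' := [a, b, e]) (b' := [e, b, a]) (by simp) (by simp)
    have h₂ := S.iioo_insert o a b [crossAt [a] o b e [], crossAt [] o a e [b]] [] [e] []
      (a' := [a, b, e]) (b' := [e, b, a]) (by simp) (by simp)
    -- The auxiliary crossing may have either sign; `o` puts the strand `e` at an extreme level.
    have h₃ := S.r3 a b e o o o (by simp)
    have h₄ := S.smoothing_slide o a b e
    simp at h₁ h₂ h₄ ⊢
    rw [h₁, h₂, h₃, h₄]
  | ioio a =>
    have h₁ := val_congr_add (S.ioio a) [] [crossAt [a] o (!a) e [], crossAt [] o a e [!a]] [] [e]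
      (a' := [a, !a, e]) (b' := [e, a, !a]) (by simp) (by simp)
    have h₂ := val_congr_add (S.ioio a) [crossAt [a] o (!a) e [], crossAt [] o a e [!a]] [] [e] []
      (a' := [a, !a, e]) (b' := [e, a, !a]) (by simp) (by simp)
    have h₃ := val_congr (S.cup_slide o a e) [capAt [] a [e]] [] [] []
      (a' := [a, !a, e]) (b' := [e, a, !a]) (by simp) (by simp)
    have h₄ := val_congr (S.cap_slide o a e) [] [cupAt [e] a []] [] []
      (a' := [a, !a, e]) (b' := [e, a, !a]) (by simp) (by simp)
    simp at h₁ h₂ h₃ h₄ ⊢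
    rw [h₁, h₂, h₃, h₄]

theorem r5 (S : SkeinTheory n ψ) (v : Vertex) (o : Bool) :
    val ψ [(Node.vertex v).bl, (Node.vertex v).br] [(Node.vertex v).tr, (Node.vertex v).tl]
        [vertexAt [] v [], crossAt [] o (Node.vertex v).tl (Node.vertex v).tr []] =
      val ψ [(Node.vertex v).bl, (Node.vertex v).br] [(Node.vertex v).tr, (Node.vertex v).tl]
        [crossAt [] o (Node.vertex v).bl (Node.vertex v).br [], vertexAt [] v.flip []] := by
  cases v with
  | iioo a b =>
    have h₁ := S.crossing_insert o b a [iiooAt [] a b []] [] [] []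
      (a' := [a, b]) (b' := [a, b]) (by simp) (by simp)
    have h₂ := S.crossing_insert o a b [] [iiooAt [] b a []] [] []
      (a' := [a, b]) (b' := [a, b]) (by simp) (by simp)
    rw [crossingSign_comm o a b] at h₁
    simp at h₁ h₂
    simp only [Vertex.flip, Node.bl_iioo, Node.br_iioo, Node.tl_iioo, Node.tr_iioo, h₁, h₂]
    by_cases hab : b = a
    · subst hab
      simp
    · obtain rfl : b = !a := Bool.eq_not.2 hab
      have l := val_congr_smul (S.cup_iioo (!a)) [capAt [] a []] [] [] []
        (a' := [a, !a]) (b' := [a, !a]) (by simp) (by simp)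
      have r := val_congr_smul (S.iioo_cap (!a)) [] [cupAt [] a []] [] []
        (a' := [a, !a]) (b' := [a, !a]) (by simp) (by simp)
      simp at l r
      simp [l, r]
  | ioio a =>
    have h₁ := val_congr_add (S.ioio a) [] [crossAt [] o a (!a) []] [] []
      (a' := [a, !a]) (b' := [!a, a]) (by simp) (by simp)
    have h₂ := val_congr_add (S.ioio (!a)) [crossAt [] o a (!a) []] [] [] []
      (a' := [a, !a]) (b' := [!a, a]) (by simp) (by simp)
    have l := val_congr (S.cup_cross o a) [capAt [] a []] [] [] []
      (a' := [a, !a]) (b' := [!a, a]) (by simp) (by simp)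
    have r := val_congr (S.cross_cap o (!a)) [] [cupAt [] (!a) []] [] []
      (a' := [a, !a]) (b' := [!a, a]) (by simp) (by simp)
    simp at h₁ h₂ l r
    simp only [Vertex.flip, Node.bl_ioio, Node.br_ioio, Node.tl_ioio, Node.tr_ioio, h₁, h₂, l, r]

/-! ### The triangle whose boundary is a directed cycle -/

/-- Resolution of the left-hand side of `R3` for strands of alternating orientations. -/
theorem expand_r3_left (S : SkeinTheory n ψ) (a : Bool) :
    val ψ [a, !a, a] [a, !a, a] [crossAt [] true a (!a) [a], crossAt [!a] true a a [],
        crossAt [] true (!a) a [a]] =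
      (T (-1 * n) * T n * T (-1 * n) : ℤ[T;T⁻¹]) •
        ((T (-1) : ℤ[T;T⁻¹]) • val ψ [a, !a, a] [a, !a, a] [] + qint (n - 3) •
            val ψ [a, !a, a] [a, !a, a] [capAt [] a [a], cupAt [] a [a]]
          + (T 1 : ℤ[T;T⁻¹]) •
            val ψ [a, !a, a] [a, !a, a] [capAt [] a [a], cupAt [a] (!a) []]
          + (T 1 : ℤ[T;T⁻¹]) •
            val ψ [a, !a, a] [a, !a, a] [capAt [a] (!a) [], cupAt [] a [a]]
          - val ψ [a, !a, a] [a, !a, a]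
            [iiooAt [] a (!a) [a], iiooAt [!a] a a [], iiooAt [] (!a) a [a]]) := by
  have c := val_congr_smul (S.circle (!a)) [capAt [] a [a]] [cupAt [] a [a]] [] [a]
    (a' := [a, !a, a]) (b' := [a, !a, a]) (by simp) (by simp)
  have l := val_congr_smul (S.cup_iioo (!a)) [capAt [] a [a]] [] [] [a]
    (a' := [a, !a, a]) (b' := [a, !a, a]) (by simp) (by simp)
  have r := val_congr_smul (S.iioo_cap (!a)) [] [cupAt [] a [a]] [] [a]
    (a' := [a, !a, a]) (b' := [a, !a, a]) (by simp) (by simp)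
  have m := val_congr_smul (S.loop_left a) [capAt [] a [a]] [cupAt [] a [a]] [] []
    (a' := [a, !a, a]) (b' := [a, !a, a]) (by simp) (by simp)
  have b := val_congr_add (S.bigon_antiparallel a) [] [] [] [a]
    (a' := [a, !a, a]) (b' := [a, !a, a]) (by simp) (by simp)
  have b₁ := val_congr_add (S.bigon_antiparallel a) [capAt [] a [a], cupAt [a] (!a) []] [] [] [a]
    (a' := [a, !a, a]) (b' := [a, !a, a]) (by simp) (by simp)
  have b₂ := val_congr_add (S.bigon_antiparallel a) [] [capAt [a] (!a) [], cupAt [] a [a]] [] [a]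
    (a' := [a, !a, a]) (b' := [a, !a, a]) (by simp) (by simp)
  have t₁ := val_congr (S.cup_rot (.vertex (.iioo a (!a)))) [capAt [] a [a]]
    [iiooAt [] (!a) a [a]] [] [] (a' := [a, !a, a]) (b' := [a, !a, a]) (by simp) (by simp)
  have t₂ := val_congr (S.rot_cap (.vertex (.iioo a a))) [iiooAt [] a (!a) [a]]
    [cupAt [] a [a]] [] [] (a' := [a, !a, a]) (b' := [a, !a, a]) (by simp) (by simp)
  have z₁ := val_congr (S.zigzag_right a) [capAt [] a [a]] [cupAt [] a [a]] [] []
    (a' := [a, !a, a]) (b' := [a, !a, a]) (by simp) (by simp)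
  have z₂ := val_congr (S.zigzag_left a) [capAt [] a [a]] [cupAt [] a [a]] [] []
    (a' := [a, !a, a]) (b' := [a, !a, a]) (by simp) (by simp)
  simp at c l r m b b₁ b₂ t₁ t₂ z₁ z₂
  have s₁ : crossingSign true a (!a) = -1 := by cases a <;> rfl
  have s₂ : crossingSign true a a = 1 := by cases a <;> rfl
  have s₃ : crossingSign true (!a) a = -1 := by cases a <;> rfl
  -- All terms but the last one contain a circle, a loop or a bigon.
  rw [S.expand_three [] [a] [!a] [] [] [a] _ _ _ _ _ _ _ _ _ (by simp), s₁, s₂, s₃]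
  simp only [smoothing_self, smoothing_not, smoothing_not', List.map_cons, List.map_nil,
    List.append_nil, List.nil_append, List.cons_append, Slice.whisker, one_mul, neg_neg,
    c, l, r, m, b, b₁, b₂, z₁, z₂, t₁, ← t₂]
  have q₁ := qint_recurrence n
  have q₂ := qint_recurrence (n - 1)
  rw [show n - 1 - 2 = n - 3 by ring, show n - 1 - 1 = n - 2 by ring] at q₂
  have q₃ := T_one_mul_T_neg_one
  rw [eq_sub_of_add_eq q₁, eq_sub_of_add_eq' q₂]
  match_scalars <;> grind

/-- Resolution of the right-hand side of `R3` for strands of alternating orientations. -/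
theorem expand_r3_right (S : SkeinTheory n ψ) (a : Bool) :
    val ψ [a, !a, a] [a, !a, a] [crossAt [a] true (!a) a [], crossAt [] true a a [!a],
        crossAt [a] true a (!a) []] =
      (T (-1 * n) * T n * T (-1 * n) : ℤ[T;T⁻¹]) •
        ((T (-1) : ℤ[T;T⁻¹]) • val ψ [a, !a, a] [a, !a, a] [] + qint (n - 3) •
            val ψ [a, !a, a] [a, !a, a] [capAt [a] (!a) [], cupAt [a] (!a) []]
          + (T 1 : ℤ[T;T⁻¹]) •
            val ψ [a, !a, a] [a, !a, a] [capAt [] a [a], cupAt [a] (!a) []]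
          + (T 1 : ℤ[T;T⁻¹]) •
            val ψ [a, !a, a] [a, !a, a] [capAt [a] (!a) [], cupAt [] a [a]]
          - val ψ [a, !a, a] [a, !a, a]
            [iiooAt [a] (!a) a [], iiooAt [] a a [!a], iiooAt [a] a (!a) []]) := by
  have c := val_congr_smul (S.circle a) [capAt [a] (!a) []] [cupAt [a] (!a) []] [a] []
    (a' := [a, !a, a]) (b' := [a, !a, a]) (by simp) (by simp)
  have l := val_congr_smul (S.cup_iioo a) [capAt [a] (!a) []] [] [a] []
    (a' := [a, !a, a]) (b' := [a, !a, a]) (by simp) (by simp)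
  have r := val_congr_smul (S.iioo_cap a) [] [cupAt [a] (!a) []] [a] []
    (a' := [a, !a, a]) (b' := [a, !a, a]) (by simp) (by simp)
  have m := val_congr_smul (S.loop_right a) [capAt [a] (!a) []] [cupAt [a] (!a) []] [] []
    (a' := [a, !a, a]) (b' := [a, !a, a]) (by simp) (by simp)
  have b := val_congr_add (S.bigon_antiparallel (!a)) [] [] [a] []
    (a' := [a, !a, a]) (b' := [a, !a, a]) (by simp) (by simp)
  have b₁ := val_congr_add (S.bigon_antiparallel (!a)) [capAt [a] (!a) [], cupAt [] a [a]] []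
    [a] [] (a' := [a, !a, a]) (b' := [a, !a, a]) (by simp) (by simp)
  have b₂ := val_congr_add (S.bigon_antiparallel (!a)) [] [capAt [] a [a], cupAt [a] (!a) []]
    [a] [] (a' := [a, !a, a]) (b' := [a, !a, a]) (by simp) (by simp)
  have t₁ := val_congr (S.cup_rot (.vertex (.iioo a a))) [capAt [a] (!a) []]
    [iiooAt [a] a (!a) []] [] [] (a' := [a, !a, a]) (b' := [a, !a, a]) (by simp) (by simp)
  have t₂ := val_congr (S.rot_cap (.vertex (.iioo a (!a)))) [iiooAt [a] (!a) a []]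
    [cupAt [a] (!a) []] [] [] (a' := [a, !a, a]) (b' := [a, !a, a]) (by simp) (by simp)
  have z₁ := val_congr (S.zigzag_right a) [capAt [a] (!a) []] [cupAt [a] (!a) []] [] []
    (a' := [a, !a, a]) (b' := [a, !a, a]) (by simp) (by simp)
  have z₂ := val_congr (S.zigzag_left a) [capAt [a] (!a) []] [cupAt [a] (!a) []] [] []
    (a' := [a, !a, a]) (b' := [a, !a, a]) (by simp) (by simp)
  simp at c l r m b b₁ b₂ t₁ t₂ z₁ z₂
  have s₁ : crossingSign true a (!a) = -1 := by cases a <;> rfl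
  have s₂ : crossingSign true a a = 1 := by cases a <;> rfl
  have s₃ : crossingSign true (!a) a = -1 := by cases a <;> rfl
  rw [S.expand_three [a] [] [] [!a] [a] [] _ _ _ _ _ _ _ _ _ (by simp), s₁, s₂, s₃]
  simp only [smoothing_self, smoothing_not, smoothing_not', List.map_cons, List.map_nil,
    List.append_nil, List.nil_append, List.cons_append, Slice.whisker, one_mul, neg_neg,
    c, l, r, m, b, b₁, b₂, z₁, z₂, ← t₁, t₂]
  have q₁ := qint_recurrence n
  have q₂ := qint_recurrence (n - 1)
  rw [show n - 1 - 2 = n - 3 by ring, show n - 1 - 1 = n - 2 by ring] at q₂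
  have q₃ := T_one_mul_T_neg_one
  rw [eq_sub_of_add_eq q₁, eq_sub_of_add_eq' q₂]
  match_scalars <;> grind

/-- The relation for a triangle whose boundary is a directed cycle is a consequence of the other
local relations: compare the resolutions of the two sides of `R3` for strands of alternating
orientations. -/
theorem triangle_cyclic (S : SkeinTheory n ψ) (a : Bool) :
    val ψ [a, !a, a] [a, !a, a] [iiooAt [] a (!a) [a], iiooAt [!a] a a [], iiooAt [] (!a) a [a]] +
        qint (n - 3) • val ψ [a, !a, a] [a, !a, a] [capAt [a] (!a) [], cupAt [a] (!a) []] =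
      val ψ [a, !a, a] [a, !a, a] [iiooAt [a] (!a) a [], iiooAt [] a a [!a], iiooAt [a] a (!a) []] +
        qint (n - 3) • val ψ [a, !a, a] [a, !a, a] [capAt [] a [a], cupAt [] a [a]] := by
  have h := S.r3 a (!a) a true true true (by simp)
  rw [S.expand_r3_left, S.expand_r3_right] at h
  have hu : IsUnit (T (-1 * n) * T n * T (-1 * n) : ℤ[T;T⁻¹]) :=
    ((isUnit_T _).mul (isUnit_T _)).mul (isUnit_T _)
  have h' := hu.smul_left_cancel.1 h
  linear_combination (norm := module) -h'

/-! ### Invariance -/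

/-- The local pictures on the two sides of a Reidemeister-type move have the same value. -/
theorem reidemeister (S : SkeinTheory n ψ) {u v : Word} (h : ReidemeisterMove u v) :
    ∃ a b, u ≠ [] ∧ IsTangle a u b ∧ val ψ a b u = val ψ a b v := by
  cases h with
  | r1_right o a => exact ⟨_, _, by simp, by simp, S.r1_right o a⟩
  | r1_left o a => exact ⟨_, _, by simp, by simp, S.r1_left o a⟩
  | r2 o a b => exact ⟨_, _, by simp, by simp, S.r2 o a b⟩
  | r3 a b c o₁₂ o₁₃ o₂₃ h => exact ⟨_, _, by simp, by simp, S.r3 a b c o₁₂ o₁₃ o₂₃ h⟩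
  | r4 v o e => exact ⟨_, _, by simp, by simp, S.r4 v o e⟩
  | r5 v o => exact ⟨_, _, by simp, by simp, S.r5 v o⟩

theorem planar_value (S : SkeinTheory n ψ) {u v : Word} (h : PlanarMove u v) :
    ∃ a b, u ≠ [] ∧ IsTangle a u b ∧ val ψ a b u = val ψ a b v := by
  cases h with
  | interchange g h m => exact ⟨_, _, by simp, by simp, S.interchange g h m⟩
  | zigzag_right a => exact ⟨_, _, by simp, by simp, S.zigzag_right a⟩
  | zigzag_left a => exact ⟨_, _, by simp, by simp, S.zigzag_left a⟩
  | rotate x => exact ⟨_, _, by simp, by simp, S.rotate x⟩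

theorem invariant (S : SkeinTheory n ψ) {D D' : Diagram} (h : D.Step D') :
    ψ D.word = ψ D'.word := by
  obtain ⟨c, u, v, h, hD, hD'⟩ := h
  obtain ⟨a, b, hne, hu, e⟩ := h.elim S.planar_value S.reidemeister
  have hc : c.Fits a b := Context.fits_of_closed hu hne (hD ▸ D.closed)
  rw [hD, hD']
  exact congrFun e ⟨c, hc⟩

end SkeinTheory

end Skein

section StateSum

variable {N : ℕ}

/-! ### The state sum: local weights -/

/-- The colours of the strands are the basis vectors of the `N`-dimensional vector representation,
numbered from `0` to `N - 1`.  Their weights have exponents `N - 1, N - 3, …, 1 - N`. -/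
def colorExp (i : Fin N) : ℤ := N - 1 - 2 * (i : ℤ)

/-- `1` for upward and `-1` for downward strands. -/
def orientSign (a : Bool) : ℤ := if a then 1 else -1

/-- Weight of a minimum with left leg `d` in colour `i`.  The weights of minima and maxima are
distributed in such a way that only integral powers of `q` occur. -/
noncomputable def cupWeight (d : Bool) (i : Fin N) : ℤ[T;T⁻¹] := if d then T (colorExp i) else 1

/-- Weight of a maximum with left leg `d` in colour `i`. -/
noncomputable def capWeight (d : Bool) (i : Fin N) : ℤ[T;T⁻¹] := if d then 1 else T (-colorExp i)

/-- `q ^ s` or `q ^ (-s)` according to the order of the two colours. -/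
noncomputable def orderWeight (s : ℤ) (i k : Fin N) : ℤ[T;T⁻¹] := if i < k then T s else T (-s)

@[simp] theorem orientSign_not (a : Bool) : orientSign (!a) = -orientSign a := by
  cases a <;> rfl

theorem orientSign_eq (a : Bool) : orientSign a = 1 ∨ orientSign a = -1 := by
  cases a <;> simp [orientSign]

theorem cupWeight_mul_capWeight (d : Bool) (i : Fin N) :
    cupWeight d i * capWeight d i = T (orientSign d * colorExp i) := by
  cases d <;> simp [cupWeight, capWeight, orientSign]

theorem cupWeight_mul_capWeight_not (d : Bool) (i : Fin N) :
    cupWeight d i * capWeight (!d) i = 1 := by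
  cases d
  · simp [cupWeight, capWeight]
  · exact T_mul_T_neg _

theorem orderWeight_swap (s : ℤ) {i k : Fin N} (h : k ≠ i) :
    orderWeight s k i = orderWeight (-s) i k := by
  rcases lt_or_gt_of_ne h with h | h <;> simp [orderWeight, h, h.not_gt]

/-- The state sum of a maximum with left leg `c` below a minimum with left leg `d`, as an operator
on functions of the colours of the two top legs. -/
noncomputable def turnback (c d : Bool) (g : Fin N → Fin N → ℤ[T;T⁻¹]) (i j : Fin N) : ℤ[T;T⁻¹] :=
  if i = j then ∑ k, capWeight c i * cupWeight d k * g k k else 0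

/-- The state sum of an oriented smoothing. -/
noncomputable def smoothingOp (a b : Bool) (g : Fin N → Fin N → ℤ[T;T⁻¹]) (i j : Fin N) :
    ℤ[T;T⁻¹] :=
  if a = b then g i j else turnback a b g i j

/-- The state sum of an In-In-Out-Out vertex with bottom legs `a`, `b`.  Two different colours meet
at the vertex.  Either both strands go straight through, with weight `1`, or they are separated as
in the oriented smoothing, with weight `q` or `q⁻¹` according to the order of the colours (and with
the weights of the maximum and the minimum in the smoothing). -/
noncomputable def vertexOp (a b : Bool) (g : Fin N → Fin N → ℤ[T;T⁻¹]) (i j : Fin N) : ℤ[T;T⁻¹] :=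
  if a = b then
    if i = j then 0 else orderWeight (orientSign b) i j * g i j + g j i
  else
    if i = j then ∑ k, if k = i then 0 else
      capWeight a i * cupWeight b k * orderWeight (orientSign b) i k * g k k
    else g j i

/-! ### Summation over a colour -/

/-- The factor `q ^ s - q ^ (-s)` turns geometric sums into telescoping ones. -/
theorem sum_telescope {s : ℤ} (G : ℕ → ℤ[T;T⁻¹]) (F : Fin N → ℤ[T;T⁻¹])
    (h : ∀ k : Fin N, F k * (T s - T (-s)) = G k - G (k + 1)) :
    (∑ k, F k) * (T s - T (-s)) = G 0 - G N := by
  rw [Finset.sum_mul, Finset.sum_congr rfl fun k _ => h k,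
    Fin.sum_univ_eq_sum_range (fun k => G k - G (k + 1)) N, Finset.sum_range_sub']

theorem qint_mul_sign (m : ℤ) {s : ℤ} (hs : s = 1 ∨ s = -1) :
    qint m * (T s - T (-s)) = T (s * m) - T (-(s * m)) := by
  have := qint_mul m
  rcases hs with rfl | rfl
  · simpa using this
  · simp only [neg_neg, neg_mul, one_mul]
    linear_combination -this

theorem T_sign_sub_ne_zero {s : ℤ} (hs : s = 1 ∨ s = -1) : (T s - T (-s) : ℤ[T;T⁻¹]) ≠ 0 := by
  rcases hs with rfl | rfl
  · exact T_one_sub_ne_zero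
  · rw [neg_neg, ← neg_sub]
    exact neg_ne_zero.2 T_one_sub_ne_zero

theorem sum_circle {s : ℤ} (hs : s = 1 ∨ s = -1) :
    ∑ k : Fin N, T (s * colorExp k) = qint N := by
  apply mul_right_cancel₀ (T_sign_sub_ne_zero hs)
  rw [sum_telescope (fun k => T (s * (N - 2 * k))), qint_mul_sign _ hs]
  · congr 2
    ring
  · intro k
    simp only [mul_sub, ← T_add, colorExp]
    congr 2 <;> push_cast <;> ring

theorem sum_loop {s : ℤ} (hs : s = 1 ∨ s = -1) (i : Fin N) :
    ∑ k, (if k = i then 0 else T (s * colorExp k) * orderWeight s i k) = qint (N - 1) := by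
  apply mul_right_cancel₀ (T_sign_sub_ne_zero hs)
  -- The jump of the second factor makes the term with `k = i` vanish.
  rw [sum_telescope (fun k => T (s * (N - 2 * k)) * if k ≤ i then T (-s) else T s),
    qint_mul_sign _ hs]
  · simp only [Nat.zero_le, if_true, not_le.2 i.2, if_false, ← T_add]
    congr 2 <;> push_cast <;> ring
  · intro k
    rcases lt_trichotomy k i with h | h | h
    · have h' : (k : ℕ) < i := h
      simp only [h.ne, orderWeight, h.not_gt, if_false, h'.le, Nat.succ_le_of_lt h', if_true,
        mul_sub, ← T_add, colorExp]
      congr 2 <;> push_cast <;> ring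
    · subst h
      simp only [if_true, zero_mul, le_refl, Nat.not_succ_le_self, if_false, ← T_add]
      rw [eq_comm, sub_eq_zero]
      congr 1; push_cast; ring
    · have h' : (i : ℕ) < k := h
      simp only [h.ne', orderWeight, h, if_false, h'.not_ge, if_true, mul_sub, ← T_add, colorExp,
        show ¬ ((k : ℕ) + 1 ≤ i) by omega]
      congr 2 <;> push_cast <;> ring

theorem sum_bigon {s : ℤ} (hs : s = 1 ∨ s = -1) (i m : Fin N) :
    ∑ k, (if k = i ∨ k = m then 0 else
        T (s * colorExp k) * orderWeight s i k * orderWeight s m k) =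
      (if i = m then T (s * colorExp i) else 0) + qint (N - 2) := by
  suffices h : ∑ k, ((if k = i ∨ k = m then 0 else
        T (s * colorExp k) * orderWeight s i k * orderWeight s m k) -
        (if k = i then if i = m then T (s * colorExp i) else 0 else 0)) = qint (N - 2) by
    rw [Finset.sum_sub_distrib, Finset.sum_ite_eq' Finset.univ i, if_pos (Finset.mem_univ i)] at h
    linear_combination h
  apply mul_right_cancel₀ (T_sign_sub_ne_zero hs)
  -- The jumps at `i` and `m` make these terms vanish if `i ≠ m`; a double jump leaves a correction.
  rw [sum_telescope (fun k => T (s * (N - 2 * k)) * ((if k ≤ i then T (-s) else T s) *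
    (if k ≤ m then T (-s) else T s))), qint_mul_sign _ hs]
  · simp only [Nat.zero_le, if_true, not_le.2 i.2, not_le.2 m.2, if_false, ← T_add]
    congr 2 <;> push_cast <;> ring
  · intro k
    have key : ∀ j : Fin N, (k : ℕ) ≤ j ∧ ((k : ℕ) + 1 ≤ j) ∧ k ≠ j ∧ ¬ j < k ∨
        (k : ℕ) ≤ j ∧ (¬ (k : ℕ) + 1 ≤ j) ∧ k = j ∧ ¬ j < k ∨
        (¬ (k : ℕ) ≤ j) ∧ (¬ (k : ℕ) + 1 ≤ j) ∧ k ≠ j ∧ j < k := by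
      intro j
      simp only [Fin.ext_iff, Fin.lt_def, ne_eq]
      omega
    rcases key i with ⟨a₁, a₂, a₃, a₄⟩ | ⟨a₁, a₂, rfl, a₄⟩ | ⟨a₁, a₂, a₃, a₄⟩ <;>
    rcases key m with ⟨b₁, b₂, b₃, b₄⟩ | ⟨b₁, b₂, rfl, b₄⟩ | ⟨b₁, b₂, b₃, b₄⟩ <;>
    simp only [*, orderWeight, if_true, if_false, or_self, or_true, true_or, mul_sub, sub_zero,
      zero_sub, zero_mul, ← T_add, colorExp, sub_self, neg_mul, sub_neg_eq_add,
      neg_add_eq_sub] <;>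
    congr 2 <;> push_cast <;> ring_nf

/-! ### The state sum: relations between local operators -/

theorem vertexOp_self (a : Bool) (g : Fin N → Fin N → ℤ[T;T⁻¹]) (i j : Fin N) :
    vertexOp a a g i j =
      if i = j then 0 else orderWeight (orientSign a) i j * g i j + g j i := by
  simp [vertexOp]

theorem vertexOp_not (a : Bool) (g : Fin N → Fin N → ℤ[T;T⁻¹]) (i j : Fin N) :
    vertexOp a (!a) g i j =
      if i = j then ∑ k, if k = i then 0 else
        capWeight a i * cupWeight (!a) k * orderWeight (-orientSign a) i k * g k k
      else g j i := by
  simp [vertexOp]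

theorem vertexOp_not' (a : Bool) (g : Fin N → Fin N → ℤ[T;T⁻¹]) (i j : Fin N) :
    vertexOp (!a) a g i j =
      if i = j then ∑ k, if k = i then 0 else
        capWeight (!a) i * cupWeight a k * orderWeight (orientSign a) i k * g k k
      else g j i := by
  simpa using vertexOp_not (!a) g i j

theorem orderWeight_add_swap {a : Bool} {i j : Fin N} (h : i ≠ j) :
    orderWeight (orientSign a) i j + orderWeight (orientSign a) j i = qint 2 := by
  rw [orderWeight_swap _ h.symm, qint_two]
  unfold orderWeight
  rcases orientSign_eq a with ha | ha <;> split_ifs <;> simp [ha, add_comm]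

theorem orderWeight_mul_swap {a : Bool} {i j : Fin N} (h : i ≠ j) :
    orderWeight (orientSign a) i j * orderWeight (orientSign a) j i = 1 := by
  rw [orderWeight_swap _ h.symm]
  unfold orderWeight
  split_ifs <;> rw [← T_add] <;> simp

theorem vertexOp_bigon_parallel (a : Bool) (g : Fin N → Fin N → ℤ[T;T⁻¹]) (i j : Fin N) :
    vertexOp a a (vertexOp a a g) i j = qint 2 * vertexOp a a g i j := by
  by_cases h : i = j
  · simp [vertexOp_self, h]
  · have h₁ := orderWeight_add_swap (a := a) h
    have h₂ := orderWeight_mul_swap (a := a) h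
    simp only [vertexOp_self, h, Ne.symm h, if_false, ← h₁]
    linear_combination -g i j * h₂

theorem cupWeight_not_mul_capWeight (d : Bool) (i : Fin N) :
    cupWeight (!d) i * capWeight d i = 1 := by
  simpa using cupWeight_mul_capWeight_not (!d) i

theorem sum_bigon_weight (a : Bool) (i m : Fin N) :
    (∑ k, if k = i then 0 else if m = k then 0 else
        capWeight a i * cupWeight (!a) k * orderWeight (-orientSign a) i k *
          (capWeight (!a) k * cupWeight a m * orderWeight (orientSign a) k m)) =
      (if m = i then 1 else 0) + qint (N - 2) * (capWeight a i * cupWeight a m) := by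
  have hs : -orientSign a = 1 ∨ -orientSign a = -1 := by
    rcases orientSign_eq a with h | h <;> simp [h]
  calc
    _ = (capWeight a i * cupWeight a m) * ∑ k, (if k = i ∨ k = m then 0 else
        T (-orientSign a * colorExp k) * orderWeight (-orientSign a) i k *
          orderWeight (-orientSign a) m k) := by
      rw [Finset.mul_sum]
      refine Finset.sum_congr rfl fun k _ => ?_
      by_cases h₁ : k = i
      · simp [h₁]
      by_cases h₂ : k = m
      · simp [h₂]
      have w := cupWeight_mul_capWeight (!a) k
      rw [orientSign_not] at w
      simp only [h₁, h₂, Ne.symm h₂, or_self, if_false, ← w]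
      rw [orderWeight_swap (orientSign a) h₂]
      ring
    _ = _ := by
      rw [sum_bigon hs]
      by_cases h : i = m
      · subst h
        have w := T_mul_T_neg (orientSign a * colorExp i)
        rw [← cupWeight_mul_capWeight] at w
        simp only [if_true, neg_mul]
        linear_combination w
      · simp only [h, Ne.symm h, if_false]
        ring

theorem vertexOp_bigon_antiparallel (a : Bool) (g : Fin N → Fin N → ℤ[T;T⁻¹]) (i j : Fin N) :
    vertexOp a (!a) (vertexOp (!a) a g) i j = g i j + qint (N - 2) * turnback a a g i j := by
  by_cases h : i = j
  · subst h
    calc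
      _ = ∑ k, ∑ m, (if k = i then 0 else if m = k then 0 else
          capWeight a i * cupWeight (!a) k * orderWeight (-orientSign a) i k *
            (capWeight (!a) k * cupWeight a m * orderWeight (orientSign a) k m)) * g m m := by
        rw [vertexOp_not, if_pos rfl]
        refine Finset.sum_congr rfl fun k _ => ?_
        by_cases hk : k = i
        · simp [hk]
        · simp only [hk, if_false, vertexOp_not', if_true, Finset.mul_sum]
          refine Finset.sum_congr rfl fun m _ => ?_
          split_ifs <;> ring
      _ = ∑ m, ((if m = i then 1 else 0) + qint (N - 2) * (capWeight a i * cupWeight a m)) *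
          g m m := by
        rw [Finset.sum_comm]
        refine Finset.sum_congr rfl fun m _ => ?_
        rw [← Finset.sum_mul, sum_bigon_weight]
      _ = _ := by
        simp only [add_mul, Finset.sum_add_distrib, turnback, if_true, Finset.mul_sum, ite_mul,
          one_mul, zero_mul, Finset.sum_ite_eq', Finset.mem_univ, mul_assoc]
  · simp [vertexOp_not, vertexOp_not', turnback, h, Ne.symm h]

theorem vertexOp_rotate (a b : Bool) (g : Fin N → Fin N → ℤ[T;T⁻¹]) (i j : Fin N) :
    vertexOp (!b) a g i j =
      ∑ k, cupWeight b k *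
        vertexOp a b (fun p q => if i = p then capWeight (!b) i * g q k else 0) j k := by
  by_cases hab : b = a
  · subst hab
    by_cases h : i = j
    · subst h
      simp only [vertexOp_self, vertexOp_not', if_true]
      refine Finset.sum_congr rfl fun k _ => ?_
      by_cases hk : k = i
      · simp [hk]
      · simp only [hk, Ne.symm hk, if_false]
        ring
    · rw [vertexOp_not', if_neg h, Finset.sum_eq_single i]
      · have w := cupWeight_mul_capWeight_not b i
        simp only [vertexOp_self, h, Ne.symm h, if_false, if_true]
        linear_combination -g j i * w
      · intro k _ hk
        simp [vertexOp_self, h, Ne.symm hk]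
      · simp
  · obtain rfl : b = !a := Bool.eq_not.2 hab
    have w := fun k : Fin N => cupWeight_not_mul_capWeight a k
    rw [Bool.not_not]
    by_cases h : i = j
    · subst h
      rw [eq_comm, vertexOp_self, if_pos rfl]
      refine Finset.sum_eq_zero fun k _ => ?_
      rw [vertexOp_not]
      by_cases hk : i = k
      · subst hk
        rw [if_pos rfl, Finset.sum_eq_zero, mul_zero]
        intro m _
        by_cases hm : m = i
        · simp [hm]
        · simp [Ne.symm hm]
      · simp [hk]
    · rw [vertexOp_self, if_neg h, ← Finset.add_sum_erase _ _ (Finset.mem_univ i),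
        ← Finset.add_sum_erase _ _ (Finset.mem_erase.2 ⟨Ne.symm h, Finset.mem_univ j⟩),
        Finset.sum_eq_zero]
      · simp only [vertexOp_not, Ne.symm h, if_false, if_true]
        rw [Finset.sum_eq_single i]
        · rw [if_neg h, if_pos rfl, orderWeight_swap _ (Ne.symm h), neg_neg]
          have w₁ := w i
          have w₂ := w j
          linear_combination -g j i * w₁ - orderWeight (orientSign a) i j * g i j * w₁ -
            orderWeight (orientSign a) i j * g i j * w₂ * (cupWeight (!a) i * capWeight a i)
        · intro m _ hm
          simp [Ne.symm hm]
        · simp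
      · intro k hk
        simp only [Finset.mem_erase, Finset.mem_univ, and_true] at hk
        simp [vertexOp_not, Ne.symm hk.1, Ne.symm hk.2]

theorem turnback_rotate (c d : Bool) (g : Fin N → Fin N → ℤ[T;T⁻¹]) (i j : Fin N) :
    g i j = ∑ k, cupWeight (!c) k *
      turnback c d (fun p q => if i = p then capWeight (!d) i * g q k else 0) j k := by
  have w₁ := cupWeight_not_mul_capWeight c j
  have w₂ := cupWeight_mul_capWeight_not d i
  rw [Finset.sum_eq_single j]
  · rw [turnback, if_pos rfl, Finset.sum_eq_single i]
    · rw [if_pos rfl]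
      linear_combination -g i j * w₁ - g i j * w₂ * (cupWeight (!c) j * capWeight c j)
    · intro m _ hm
      simp [Ne.symm hm]
    · simp
  · intro k _ hk
    simp [turnback, Ne.symm hk]
  · simp

theorem id_rotate (c d : Bool) (g : Fin N → Fin N → ℤ[T;T⁻¹]) (i j : Fin N) :
    turnback c d g i j =
      ∑ k, cupWeight d k * (if i = j then capWeight c i * g k k else 0) := by
  by_cases h : i = j
  · simp only [turnback, h, if_true]
    exact Finset.sum_congr rfl fun k _ => by ring
  · simp [turnback, h]

theorem smoothingOp_rotate (a b : Bool) (g : Fin N → Fin N → ℤ[T;T⁻¹]) (i j : Fin N) :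
    smoothingOp (!b) a g i j =
      ∑ k, cupWeight b k *
        smoothingOp a b (fun p q => if i = p then capWeight (!b) i * g q k else 0) j k := by
  by_cases hab : b = a
  · subst hab
    simp [smoothingOp, id_rotate]
  · obtain rfl : b = !a := Bool.eq_not.2 hab
    simpa [smoothingOp] using turnback_rotate a (!a) g i j

theorem vertexOp_triangle (a : Bool) (g : Fin N → Fin N → Fin N → ℤ[T;T⁻¹]) (i j k : Fin N) :
    vertexOp a a (fun p q => vertexOp a a (fun q r => vertexOp a a (fun p q => g p q r) p q) q k)
        i j + vertexOp a a (fun q r => g i q r) j k =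
      vertexOp a a (fun q r => vertexOp a a (fun p q => vertexOp a a (fun q r => g p q r) q r) i q)
        j k + vertexOp a a (fun p q => g p q k) i j := by
  have hw : (T (orientSign a) * T (-orientSign a) : ℤ[T;T⁻¹]) = 1 := T_mul_T_neg _
  simp only [vertexOp_self, orderWeight]
  generalize (T (orientSign a) : ℤ[T;T⁻¹]) = x at *
  generalize (T (-orientSign a) : ℤ[T;T⁻¹]) = y at *
  by_cases hij : i = j
  · subst hij
    by_cases hik : i = k
    · simp [hik]
    · rcases lt_or_gt_of_ne hik with h | h <;> simp [h.ne, h.ne', h, h.not_gt] <;> grind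
  by_cases hjk : j = k
  · subst hjk
    rcases lt_or_gt_of_ne hij with h | h <;> simp [h.ne, h.ne', h, h.not_gt] <;> grind
  by_cases hik : i = k
  · subst hik
    rcases lt_or_gt_of_ne hij with h | h <;> simp [h.ne, h.ne', h, h.not_gt] <;> grind
  rcases lt_or_gt_of_ne hij with h₁ | h₁ <;> rcases lt_or_gt_of_ne hjk with h₂ | h₂ <;>
    rcases lt_or_gt_of_ne hik with h₃ | h₃ <;>
    first
    | (exfalso; order)
    | (simp only [*, h₁.ne', h₂.ne', h₃.ne', h₁.not_gt, h₂.not_gt, h₃.not_gt, if_true, if_false]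
       grind)

/-! ### The state sum of a diagram -/

/-- The state sum of an elementary piece, as an operator on functions of the list of colours of the
strands at its top; the result is a function of the list of colours at its bottom, with
value `0` at lists of the wrong length. -/
noncomputable def pieceValue : Gen → (List (Fin N) → ℤ[T;T⁻¹]) → List (Fin N) → ℤ[T;T⁻¹]
  | .cup d, f, [] => ∑ k, cupWeight d k * f [k, k]
  | .cap d, f, [i, j] => if i = j then capWeight d i * f [] else 0
  | .node (.crossing o a b), f, [i, j] =>
      T (crossingSign o a b * (N - 1)) * smoothingOp a b (fun p q => f [p, q]) i j -
        T (crossingSign o a b * N) * vertexOp a b (fun p q => f [p, q]) i j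
  | .node (.vertex (.iioo a b)), f, [i, j] => vertexOp a b (fun p q => f [p, q]) i j
  | .node (.vertex (.ioio a)), f, [i, j] => f [i, j] + turnback a a (fun p q => f [p, q]) i j
  | _, _, _ => 0

/-- The state sum of a slice: the strands beside the piece keep their colours. -/
noncomputable def sliceValue (s : Slice) (f : List (Fin N) → ℤ[T;T⁻¹]) (x : List (Fin N)) :
    ℤ[T;T⁻¹] :=
  pieceValue s.gen
    (fun y => f (x.take s.left.length ++ y ++ x.drop (s.left.length + s.gen.dom.length)))
    ((x.drop s.left.length).take s.gen.dom.length)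

/-- The state sum of a sequence of slices, as an operator that turns functions of the colours at
the top into functions of the colours at the bottom. -/
noncomputable def wordValue : Word → (List (Fin N) → ℤ[T;T⁻¹]) → List (Fin N) → ℤ[T;T⁻¹]
  | [], f => f
  | s :: w, f => sliceValue s (wordValue w f)

/-- The state sum of a closed diagram. -/
noncomputable def stateSum (N : ℕ) (w : Word) : ℤ[T;T⁻¹] :=
  wordValue w (fun _ : List (Fin N) => 1) []

/-- Finite linear combinations of evaluations of a function at lists of length `m`. -/
inductive LocalFunctional (m : ℕ) : ((List (Fin N) → ℤ[T;T⁻¹]) → ℤ[T;T⁻¹]) → Prop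
  | eval (y : List (Fin N)) (h : y.length = m) : LocalFunctional m fun f => f y
  | zero : LocalFunctional m fun _ => 0
  | add {Λ Λ' : (List (Fin N) → ℤ[T;T⁻¹]) → ℤ[T;T⁻¹]} (h : LocalFunctional m Λ)
      (h' : LocalFunctional m Λ') : LocalFunctional m fun f => Λ f + Λ' f
  | smul (r : ℤ[T;T⁻¹]) {Λ : (List (Fin N) → ℤ[T;T⁻¹]) → ℤ[T;T⁻¹]} (h : LocalFunctional m Λ) :
      LocalFunctional m fun f => r * Λ f

namespace LocalFunctional

variable {m : ℕ} {Λ Λ' : (List (Fin N) → ℤ[T;T⁻¹]) → ℤ[T;T⁻¹]}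

theorem sum {ι : Type*} (s : Finset ι) {Λ : ι → (List (Fin N) → ℤ[T;T⁻¹]) → ℤ[T;T⁻¹]}
    (h : ∀ k, LocalFunctional m (Λ k)) : LocalFunctional m fun f => ∑ k ∈ s, Λ k f := by
  classical
  induction s using Finset.induction_on with
  | empty => simpa using zero
  | insert k s hk ih => simpa [hk] using add (h k) ih

theorem ite {p : Prop} [Decidable p] (h : LocalFunctional m Λ) (h' : LocalFunctional m Λ') :
    LocalFunctional m fun f => if p then Λ f else Λ' f := by
  split_ifs
  exacts [h, h']

theorem congr (h : LocalFunctional m Λ) {f g : List (Fin N) → ℤ[T;T⁻¹]}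
    (hfg : ∀ y, y.length = m → f y = g y) : Λ f = Λ g := by
  induction h with
  | eval y hy => exact hfg y hy
  | zero => rfl
  | add _ _ ih ih' => simp only [ih, ih']
  | smul r _ ih => simp only [ih]

theorem map_zero (h : LocalFunctional m Λ) : Λ (fun _ => 0) = 0 := by
  induction h with
  | eval y hy => rfl
  | zero => rfl
  | add _ _ ih ih' => simp [ih, ih']
  | smul r _ ih => simp [ih]

theorem map_add (h : LocalFunctional m Λ) (f g : List (Fin N) → ℤ[T;T⁻¹]) :
    Λ (fun y => f y + g y) = Λ f + Λ g := by
  induction h with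
  | eval y hy => rfl
  | zero => simp
  | add _ _ ih ih' => simp only [ih, ih']; ring
  | smul r _ ih => simp only [ih]; ring

theorem map_smul (h : LocalFunctional m Λ) (r : ℤ[T;T⁻¹]) (f : List (Fin N) → ℤ[T;T⁻¹]) :
    Λ (fun y => r * f y) = r * Λ f := by
  induction h with
  | eval y hy => rfl
  | zero => simp
  | add _ _ ih ih' => simp only [ih, ih']; ring
  | smul r _ ih => simp only [ih]; ring

theorem comm {m' : ℕ} (h : LocalFunctional m Λ) (h' : LocalFunctional m' Λ')
    (F : List (Fin N) → List (Fin N) → ℤ[T;T⁻¹]) :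
    Λ (fun y => Λ' fun z => F y z) = Λ' fun z => Λ fun y => F y z := by
  induction h with
  | eval y hy => rfl
  | zero => exact h'.map_zero.symm
  | add _ _ ih ih' => simp only [ih, ih', h'.map_add]
  | smul r _ ih => simp only [ih, h'.map_smul]

theorem bind {m' : ℕ} (h : LocalFunctional m Λ)
    {E : List (Fin N) → (List (Fin N) → ℤ[T;T⁻¹]) → ℤ[T;T⁻¹]}
    (hE : ∀ y, y.length = m → LocalFunctional m' (E y)) :
    LocalFunctional m' fun f => Λ fun y => E y f := by
  induction h with
  | eval y hy => exact hE y hy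
  | zero => exact zero
  | add _ _ ih ih' => exact ih.add ih'
  | smul r _ ih => exact ih.smul r

end LocalFunctional

theorem localFunctional_turnback (c d : Bool) (i j : Fin N) :
    LocalFunctional 2 fun f => turnback c d (fun p q => f [p, q]) i j :=
  .ite (.sum _ fun _ => .smul _ (.eval _ rfl)) .zero

theorem localFunctional_smoothingOp (a b : Bool) (i j : Fin N) :
    LocalFunctional 2 fun f => smoothingOp a b (fun p q => f [p, q]) i j :=
  .ite (.eval _ rfl) (localFunctional_turnback a b i j)

theorem localFunctional_vertexOp (a b : Bool) (i j : Fin N) :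
    LocalFunctional 2 fun f => vertexOp a b (fun p q => f [p, q]) i j :=
  .ite (.ite .zero (.add (.smul _ (.eval _ rfl)) (.eval _ rfl)))
    (.ite (.sum _ fun _ => .ite .zero (.smul _ (.eval _ rfl))) (.eval _ rfl))

theorem localFunctional_pieceValue (g : Gen) (x : List (Fin N)) :
    LocalFunctional g.cod.length fun f => pieceValue g f x := by
  match g, x with
  | .cup d, [] => exact .sum _ fun _ => .smul _ (.eval _ rfl)
  | .cup d, _ :: _ => exact .zero
  | .cap d, [i, j] => exact .ite (.smul _ (.eval _ rfl)) .zero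
  | .cap d, [] | .cap d, [_] | .cap d, _ :: _ :: _ :: _ => exact .zero
  | .node (.crossing o a b), [i, j] =>
    have h := (localFunctional_smoothingOp a b i j).smul (T (crossingSign o a b * (N - 1)))
    have h' := (localFunctional_vertexOp a b i j).smul (-T (crossingSign o a b * N))
    have e := h.add h'
    simp only [neg_mul, ← sub_eq_add_neg] at e
    exact e
  | .node (.vertex (.iioo a b)), [i, j] => exact localFunctional_vertexOp a b i j
  | .node (.vertex (.ioio a)), [i, j] => exact .add (.eval _ rfl) (localFunctional_turnback a a i j)
  | .node (.crossing _ _ _), [] | .node (.crossing _ _ _), [_]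
  | .node (.crossing _ _ _), _ :: _ :: _ :: _ | .node (.vertex (.iioo _ _)), []
  | .node (.vertex (.iioo _ _)), [_] | .node (.vertex (.iioo _ _)), _ :: _ :: _ :: _
  | .node (.vertex (.ioio _)), [] | .node (.vertex (.ioio _)), [_]
  | .node (.vertex (.ioio _)), _ :: _ :: _ :: _ => exact .zero

theorem sliceValue_append (s : Slice) (f : List (Fin N) → ℤ[T;T⁻¹]) {x₁ x₂ x₃ : List (Fin N)}
    (h₁ : x₁.length = s.left.length) (h₂ : x₂.length = s.gen.dom.length) :
    sliceValue s f (x₁ ++ x₂ ++ x₃) = pieceValue s.gen (fun y => f (x₁ ++ y ++ x₃)) x₂ := by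
  have e₁ : (x₁ ++ x₂ ++ x₃).take s.left.length = x₁ := by simp [← h₁]
  have e₂ : (x₁ ++ x₂ ++ x₃).drop s.left.length = x₂ ++ x₃ := by simp [← h₁]
  rw [sliceValue, ← List.drop_drop, e₁, e₂, ← h₂, List.take_left, List.drop_left]

theorem exists_split (s : Slice) {x : List (Fin N)} (h : x.length = s.dom.length) :
    ∃ x₁ x₂ x₃, x = x₁ ++ x₂ ++ x₃ ∧ x₁.length = s.left.length ∧
      x₂.length = s.gen.dom.length ∧ x₃.length = s.right.length := by
  simp only [Slice.dom, List.length_append] at h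
  refine ⟨x.take s.left.length, (x.drop s.left.length).take s.gen.dom.length,
    (x.drop s.left.length).drop s.gen.dom.length, ?_, ?_, ?_, ?_⟩
  · rw [List.append_assoc, List.take_append_drop, List.take_append_drop]
  all_goals simp; omega

theorem localFunctional_wordValue {w : Word} {a b : List Bool} (hw : IsTangle a w b)
    {x : List (Fin N)} (hx : x.length = a.length) :
    LocalFunctional b.length fun f => wordValue w f x := by
  induction w generalizing a x with
  | nil => exact .eval x (hx.trans (congrArg _ hw))
  | cons s w ih =>
    obtain ⟨x₁, x₂, x₃, rfl, h₁, h₂, h₃⟩ := exists_split s (hx.trans (congrArg _ hw.1))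
    simp only [wordValue, sliceValue_append s _ h₁ h₂]
    refine (localFunctional_pieceValue s.gen x₂).bind fun y hy => ih hw.2 ?_
    simp [h₁, h₃, hy]

theorem wordValue_append (u v : Word) (f : List (Fin N) → ℤ[T;T⁻¹]) :
    wordValue (u ++ v) f = wordValue u (wordValue v f) := by
  induction u with
  | nil => rfl
  | cons s u ih => simp [wordValue, ih]

theorem wordValue_whisker (L R : List Bool) {w : Word} {a b : List Bool} (hw : IsTangle a w b)
    (f : List (Fin N) → ℤ[T;T⁻¹]) {l x r : List (Fin N)} (hl : l.length = L.length)
    (hx : x.length = a.length) :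
    wordValue (w.map (Slice.whisker L R)) f (l ++ x ++ r) =
      wordValue w (fun y => f (l ++ y ++ r)) x := by
  induction w generalizing a x with
  | nil => rfl
  | cons s w ih =>
    obtain ⟨x₁, x₂, x₃, rfl, h₁, h₂, h₃⟩ := exists_split s (hx.trans (congrArg _ hw.1))
    have e : l ++ (x₁ ++ x₂ ++ x₃) ++ r = (l ++ x₁) ++ x₂ ++ (x₃ ++ r) := by simp
    rw [List.map_cons, wordValue, wordValue, sliceValue_append s _ h₁ h₂, e,
      sliceValue_append (s.whisker L R) _ (by simp [hl, h₁]) h₂]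
    refine (localFunctional_pieceValue s.gen x₂).congr fun y hy => ?_
    rw [← ih hw.2 (by simp [h₁, h₃, hy])]
    simp

/-- Linear relations between the state sums of local pictures hold in all surroundings. -/
theorem sum_val_eq_zero {a b : List Bool} (l : List (ℤ[T;T⁻¹] × Word))
    (hl : ∀ p ∈ l, IsTangle a p.2 b)
    (h : ∀ (f : List (Fin N) → ℤ[T;T⁻¹]) (x : List (Fin N)), x.length = a.length →
      (l.map fun p => p.1 * wordValue p.2 f x).sum = 0) :
    (l.map fun p => p.1 • val (stateSum N) a b p.2).sum = 0 := by
  funext ⟨c, hc⟩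
  set F : List (Fin N) → ℤ[T;T⁻¹] := wordValue c.post fun _ => 1
  have hpre := localFunctional_wordValue hc.1 (x := ([] : List (Fin N))) rfl
  have key : ∀ l : List (ℤ[T;T⁻¹] × Word),
      (l.map fun p => p.1 • val (stateSum N) a b p.2).sum ⟨c, hc⟩ =
        wordValue c.pre (fun y => (l.map fun p => p.1 *
          wordValue (p.2.map (Slice.whisker c.left c.right)) F y).sum) [] := by
    intro l
    induction l with
    | nil => exact hpre.map_zero.symm
    | cons p l ih =>
      simp only [List.map_cons, List.sum_cons, Pi.add_apply, ih, hpre.map_add, hpre.map_smul]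
      simp [val, stateSum, Context.fill, wordValue_append, F]
  rw [key]
  refine (hpre.congr fun y hy => ?_).trans hpre.map_zero
  obtain ⟨y₁, x, y₂, rfl, h₁, hx, h₂⟩ : ∃ y₁ x y₂, y = y₁ ++ x ++ y₂ ∧
      y₁.length = c.left.length ∧ x.length = a.length ∧ y₂.length = c.right.length := by
    simp only [List.length_append] at hy
    refine ⟨y.take c.left.length, (y.drop c.left.length).take a.length,
      (y.drop c.left.length).drop a.length, ?_, ?_, ?_, ?_⟩
    · rw [List.append_assoc, List.take_append_drop, List.take_append_drop]
    all_goals simp; omega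
  rw [← h (fun z => F (y₁ ++ z ++ y₂)) x hx]
  congr 1
  refine List.map_congr_left fun p hp => ?_
  rw [wordValue_whisker _ _ (hl p hp) _ h₁ hx]

/-! ### The state sum satisfies the local relations -/

theorem stateSum_val_eq {a b : List Bool} {u v : Word} (hu : IsTangle a u b) (hv : IsTangle a v b)
    (h : ∀ (f : List (Fin N) → ℤ[T;T⁻¹]) (x : List (Fin N)), x.length = a.length →
      wordValue u f x = wordValue v f x) : val (stateSum N) a b u = val (stateSum N) a b v := by
  have := sum_val_eq_zero (N := N) [(1, u), (-1, v)] (a := a) (b := b) (by simp [hu, hv])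
    (fun f x hx => by simp [h f x hx])
  rw [← sub_eq_zero, ← this]
  simp [sub_eq_add_neg]

theorem stateSum_val_smul {a b : List Bool} {u v : Word} {r : ℤ[T;T⁻¹]} (hu : IsTangle a u b)
    (hv : IsTangle a v b)
    (h : ∀ (f : List (Fin N) → ℤ[T;T⁻¹]) (x : List (Fin N)), x.length = a.length →
      wordValue u f x = r * wordValue v f x) :
    val (stateSum N) a b u = r • val (stateSum N) a b v := by
  have := sum_val_eq_zero (N := N) [(1, u), (-r, v)] (a := a) (b := b) (by simp [hu, hv])
    (fun f x hx => by simp [h f x hx])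
  rw [← sub_eq_zero, ← this]
  simp [sub_eq_add_neg]

theorem stateSum_val_add {a b : List Bool} {u v w : Word} {r s : ℤ[T;T⁻¹]} (hu : IsTangle a u b)
    (hv : IsTangle a v b) (hw : IsTangle a w b)
    (h : ∀ (f : List (Fin N) → ℤ[T;T⁻¹]) (x : List (Fin N)), x.length = a.length →
      wordValue u f x = r * wordValue v f x + s * wordValue w f x) :
    val (stateSum N) a b u = r • val (stateSum N) a b v + s • val (stateSum N) a b w := by
  have := sum_val_eq_zero (N := N) [(1, u), (-r, v), (-s, w)] (a := a) (b := b)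
    (by simp [hu, hv, hw]) (fun f x hx => by simp [h f x hx]; ring)
  rw [← sub_eq_zero, ← this]
  simp
  module

theorem wordValue_interchange (g h : Gen) (m : List Bool) (f : List (Fin N) → ℤ[T;T⁻¹])
    {x : List (Fin N)} (hx : x.length = (g.dom ++ m ++ h.dom).length) :
    wordValue [⟨[], g, m ++ h.dom⟩, ⟨g.cod ++ m, h, []⟩] f x =
      wordValue [⟨g.dom ++ m, h, []⟩, ⟨[], g, m ++ h.cod⟩] f x := by
  obtain ⟨x₁, x₂, x₃, rfl, h₁, h₂, h₃⟩ := exists_split (N := N) ⟨g.dom ++ m, h, []⟩ (x := x)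
    (by simpa using hx)
  obtain ⟨y₁, y₂, y₃, rfl, h₁', h₂', h₃'⟩ := exists_split (N := N) ⟨[], g, m⟩ (x := x₁)
    (by simpa using h₁)
  obtain rfl : y₁ = [] := by simpa using h₁'
  obtain rfl : x₃ = [] := by simpa using h₃
  have e₁ : [] ++ y₂ ++ y₃ ++ x₂ ++ [] = [] ++ y₂ ++ (y₃ ++ x₂) := by simp
  simp only at h₂ h₃' h₂'
  calc
    _ = pieceValue g (fun y => pieceValue h (fun z => f (y ++ y₃ ++ z)) x₂) y₂ := by
      rw [e₁, wordValue, sliceValue_append ⟨[], g, m ++ h.dom⟩ _ rfl h₂']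
      refine (localFunctional_pieceValue g y₂).congr fun y hy => ?_
      have e₂ : [] ++ y ++ (y₃ ++ x₂) = (y ++ y₃) ++ x₂ ++ [] := by simp
      rw [e₂, wordValue, sliceValue_append ⟨g.cod ++ m, h, []⟩ _ (by simp [hy, h₃']) h₂]
      simp [wordValue]
    _ = pieceValue h (fun z => pieceValue g (fun y => f (y ++ y₃ ++ z)) y₂) x₂ :=
      (localFunctional_pieceValue g y₂).comm (localFunctional_pieceValue h x₂) _
    _ = _ := by
      rw [wordValue, sliceValue_append ⟨g.dom ++ m, h, []⟩ _ h₁ h₂]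
      refine (localFunctional_pieceValue h x₂).congr fun z hz => ?_
      have e₂ : [] ++ y₂ ++ y₃ ++ z ++ [] = [] ++ y₂ ++ (y₃ ++ z) := by simp
      rw [e₂, wordValue, sliceValue_append ⟨[], g, m ++ h.cod⟩ _ rfl h₂']
      simp [wordValue]

theorem wordValue_rotate (x : Node) (f : List (Fin N) → ℤ[T;T⁻¹]) (i j : Fin N) :
    wordValue [nodeAt [] x.rot []] f [i, j] =
      wordValue [cupAt [!x.tl, x.bl] x.br [], nodeAt [!x.tl] x [!x.br],
        capAt [] (!x.tl) [x.tr, !x.br]] f [i, j] := by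
  rcases x with ⟨o, a, b⟩ | ⟨a, b⟩ | a
  · have hs : crossingSign (!o) (!b) a = crossingSign o a b := by revert o a b; decide
    simp [wordValue, sliceValue, pieceValue, vertexOp_rotate, smoothingOp_rotate, hs, mul_sub,
      Finset.mul_sum, mul_assoc]
  · simp [wordValue, sliceValue, pieceValue, vertexOp_rotate]
  · have w₁ := cupWeight_not_mul_capWeight a j
    have w₂ := cupWeight_mul_capWeight_not a i
    have e : ∀ k, capWeight (!a) i * cupWeight (!a) k * f [k, k] =
        cupWeight (!a) k * (capWeight (!a) i * f [k, k]) := fun k => by ring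
    simp [wordValue, sliceValue, pieceValue, turnback, mul_add, Finset.sum_add_distrib, e]
    linear_combination -f [i, j] * w₁ - f [i, j] * w₂ * (cupWeight (!a) j * capWeight a j)

theorem stateSum_planar {u v : Word} {a b : List Bool} (h : PlanarMove u v) (hu : IsTangle a u b)
    (hv : IsTangle a v b) : val (stateSum N) a b u = val (stateSum N) a b v := by
  refine stateSum_val_eq hu hv fun f x hx => ?_
  cases h with
  | interchange g h m =>
    obtain rfl : a = _ := hu.1
    exact wordValue_interchange g h m f (by simpa using hx)
  | zigzag_right d =>
    obtain rfl : a = _ := hu.1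
    obtain ⟨i, rfl⟩ := List.length_eq_one_iff.1 (by simpa using hx)
    simp [wordValue, sliceValue, pieceValue, ← mul_assoc, cupWeight_not_mul_capWeight]
  | zigzag_left d =>
    obtain rfl : a = _ := hu.1
    obtain ⟨i, rfl⟩ := List.length_eq_one_iff.1 (by simpa using hx)
    simp [wordValue, sliceValue, pieceValue, ← mul_assoc, cupWeight_mul_capWeight_not]
  | rotate y =>
    obtain rfl : a = _ := hu.1
    obtain ⟨i, j, rfl⟩ := List.length_eq_two.1 (by simpa using hx)
    exact wordValue_rotate y f i j

theorem skeinTheory_stateSum (N : ℕ) : SkeinTheory (N : ℤ) (stateSum N) where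
  planar := stateSum_planar
  crossing o a b := by
    refine stateSum_val_add (by simp) (isTangle_smoothing a b) (by simp) fun f x hx => ?_
    obtain ⟨i, j, rfl⟩ := List.length_eq_two.1 hx
    by_cases h : b = a
    · subst h
      simp [wordValue, sliceValue, pieceValue, smoothingOp, sub_eq_add_neg]
    · obtain rfl : b = !a := Bool.eq_not.2 h
      simp [wordValue, sliceValue, pieceValue, smoothingOp, sub_eq_add_neg, turnback,
        Finset.mul_sum, mul_assoc]
  ioio a := by
    refine stateSum_val_add (by simp) (by simp) (by simp) fun f x hx => ?_
    obtain ⟨i, j, rfl⟩ := List.length_eq_two.1 hx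
    simp [wordValue, sliceValue, pieceValue, turnback, Finset.mul_sum, mul_assoc]
  circle a := by
    refine stateSum_val_smul (by simp) (by simp) fun f x hx => ?_
    obtain rfl : x = [] := by simpa using hx
    simp only [wordValue, sliceValue, pieceValue, ← sum_circle (N := N) (orientSign_eq a),
      Finset.sum_mul, ← cupWeight_mul_capWeight]
    simp [mul_assoc]
  loop_right a := by
    refine stateSum_val_smul (by simp) (by simp) fun f x hx => ?_
    obtain ⟨i, rfl⟩ := List.length_eq_one_iff.1 hx
    simp [wordValue, sliceValue, pieceValue, vertexOp_self]
    rw [← sum_loop (orientSign_eq a) i, Finset.sum_mul]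
    refine Finset.sum_congr rfl fun k _ => ?_
    by_cases hk : k = i
    · simp [hk]
    · simp only [hk, Ne.symm hk, if_false, ← cupWeight_mul_capWeight]
      ring
  loop_left a := by
    refine stateSum_val_smul (by simp) (by simp) fun f x hx => ?_
    obtain ⟨i, rfl⟩ := List.length_eq_one_iff.1 hx
    simp [wordValue, sliceValue, pieceValue, vertexOp_self]
    rw [← sum_loop (orientSign_eq (!a)) i, Finset.sum_mul]
    refine Finset.sum_congr rfl fun k _ => ?_
    by_cases hk : k = i
    · simp [hk]
    · simp only [hk, if_false, ← cupWeight_mul_capWeight]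
      rw [orderWeight_swap _ hk, orientSign_not]
      ring
  bigon_parallel a := by
    refine stateSum_val_smul (by simp) (by simp) fun f x hx => ?_
    obtain ⟨i, j, rfl⟩ := List.length_eq_two.1 hx
    simpa [wordValue, sliceValue, pieceValue] using vertexOp_bigon_parallel a _ i j
  bigon_antiparallel a := by
    refine stateSum_val_add (by simp) (by simp) (by simp) fun f x hx => ?_
    obtain ⟨i, j, rfl⟩ := List.length_eq_two.1 hx
    simpa [wordValue, sliceValue, pieceValue, turnback, Finset.mul_sum, mul_assoc] using
      vertexOp_bigon_antiparallel a (fun p q => f [p, q]) i j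
  triangle_acyclic a := by
    have h := sum_val_eq_zero (N := N) (a := [a, a, a]) (b := [a, a, a])
      [(1, [iiooAt [] a a [a], iiooAt [a] a a [], iiooAt [] a a [a]]),
        (1, [iiooAt [a] a a []]),
        (-1, [iiooAt [a] a a [], iiooAt [] a a [a], iiooAt [a] a a []]),
        (-1, [iiooAt [] a a [a]])] (by simp) fun f x hx => by
      obtain ⟨i, j, k, rfl⟩ := List.length_eq_three.1 hx
      have t := vertexOp_triangle a (fun p q r => f [p, q, r]) i j k
      simp [wordValue, sliceValue, pieceValue]
      linear_combination t
    simp at h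
    linear_combination (norm := module) h

end StateSum

/-! ### The skein module -/

section Combination

variable {M : Type*} [AddCommGroup M] [Module ℤ[T;T⁻¹] M] {n : ℤ} {ψ : Word → M}

theorem linearCombination_val_apply (ψ : Word → M) (a b : List Bool) (x : Combination)
    (c : {c : Context // c.Fits a b}) :
    linearCombination ℤ[T;T⁻¹] (val ψ a b) x c =
      linearCombination ℤ[T;T⁻¹] ψ (mapDomain c.1.fill x) := by
  rw [linearCombination_mapDomain]
  simp [linearCombination_apply, Finsupp.sum, val]

theorem mem_support_of_eq_zero {u : Word} {y : Combination} (h : y u = 0) :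
    u ∈ (single u (1 : ℤ[T;T⁻¹]) - y).support := by
  simp [h]

/-- Every local relation holds in a skein theory.  Moreover, unless it is trivial, a nonempty
picture occurs in it, so that its strands at the bottom and at the top are determined. -/
theorem SkeinTheory.localRelation (S : SkeinTheory n ψ) {x : Combination}
    (h : LocalRelation n x) : x = 0 ∨ ∃ a b u, u ∈ x.support ∧ u ≠ [] ∧ IsTangle a u b ∧
      linearCombination ℤ[T;T⁻¹] (val ψ a b) x = 0 := by
  cases h with
  | @planar u v h =>
    by_cases huv : u = v
    · exact .inl (by simp [huv])
    · obtain ⟨a, b, hne, hu, e⟩ := S.planar_value h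
      exact .inr ⟨a, b, u, mem_support_of_eq_zero (by simp [Ne.symm huv]), hne, hu,
        by simp [e]⟩
  | crossing o a b =>
    refine .inr ⟨[a, b], [b, a], _, mem_support_of_eq_zero ?_, by simp, by simp,
      by simp [S.crossing]⟩
    cases a <;> cases b <;> simp [smoothing]
  | ioio a =>
    exact .inr ⟨[a, !a], [a, !a], _, mem_support_of_eq_zero (by simp), by simp, by simp,
      by simp [S.ioio]⟩
  | circle a =>
    exact .inr ⟨[], [], _, mem_support_of_eq_zero (by simp), by simp, by simp, by simp [S.circle]⟩
  | loop_right a =>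
    exact .inr ⟨[a], [a], _, mem_support_of_eq_zero (by simp), by simp, by simp,
      by simp [S.loop_right]⟩
  | loop_left a =>
    exact .inr ⟨[a], [a], _, mem_support_of_eq_zero (by simp), by simp, by simp,
      by simp [S.loop_left]⟩
  | bigon_parallel a =>
    exact .inr ⟨[a, a], [a, a], _, mem_support_of_eq_zero (by simp), by simp, by simp,
      by simp [S.bigon_parallel]⟩
  | bigon_antiparallel a =>
    exact .inr ⟨[a, !a], [a, !a], _, mem_support_of_eq_zero (by simp), by simp, by simp,
      by simp [S.bigon_antiparallel]⟩
  | triangle_acyclic a =>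
    refine .inr ⟨[a, a, a], [a, a, a], [iiooAt [] a a [a], iiooAt [a] a a [], iiooAt [] a a [a]],
      ?_, by simp, by simp, ?_⟩
    · simp
    · simp only [map_sub, map_add, linearCombination_single, one_smul, S.triangle_acyclic, sub_self]
  | triangle_cyclic a =>
    refine .inr ⟨[a, !a, a], [a, !a, a],
      [iiooAt [] a (!a) [a], iiooAt [!a] a a [], iiooAt [] (!a) a [a]], ?_, by simp, by simp, ?_⟩
    · simp
    · simp only [map_sub, map_add, linearCombination_single, one_smul, S.triangle_cyclic, sub_self]

end Combination

/-- The class of a diagram in the skein module. -/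
noncomputable def skeinClass (n : ℤ) (w : Word) : Combination ⧸ skeinSubmodule n :=
  (skeinSubmodule n).mkQ (single w 1)

theorem linearCombination_skeinClass (n : ℤ) (x : Combination) :
    linearCombination ℤ[T;T⁻¹] (skeinClass n) x = (skeinSubmodule n).mkQ x := by
  induction x using Finsupp.induction_linear with
  | zero => simp
  | add x y hx hy => simp [hx, hy]
  | single w r => rw [linearCombination_single, skeinClass, ← map_smul, smul_single_one]

theorem linearCombination_skeinClass_eq_zero {n : ℤ} {x : Combination} (h : LocalRelation n x)
    {a b : List Bool} (hx : x ∈ Finsupp.supported ℤ[T;T⁻¹] ℤ[T;T⁻¹] {w | IsTangle a w b}) :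
    linearCombination ℤ[T;T⁻¹] (val (skeinClass n) a b) x = 0 := by
  funext c
  rw [linearCombination_val_apply, linearCombination_skeinClass]
  exact (Submodule.Quotient.mk_eq_zero _).2
    (Submodule.subset_span ⟨c, x, h, fun _ hw => c.2.closed (hx hw), rfl⟩)

theorem single_mem_tangles {a b : List Bool} {w : Word} (h : IsTangle a w b) (r : ℤ[T;T⁻¹]) :
    single w r ∈ Finsupp.supported ℤ[T;T⁻¹] ℤ[T;T⁻¹] {w | IsTangle a w b} :=
  single_mem_supported _ _ h

theorem skeinTheory_skeinClass (n : ℤ) : SkeinTheory n (skeinClass n) where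
  planar {u v a b} h hu hv := by
    have := linearCombination_skeinClass_eq_zero (.planar (n := n) h)
      (sub_mem (single_mem_tangles hu _) (single_mem_tangles hv _))
    simpa [sub_eq_zero] using this
  crossing o a b := by
    have := linearCombination_skeinClass_eq_zero (.crossing (n := n) o a b) (a := [a, b])
      (b := [b, a]) (sub_mem (single_mem_tangles (by simp) _)
        (sub_mem (single_mem_tangles (isTangle_smoothing a b) _) (single_mem_tangles (by simp) _)))
    simp only [map_sub, linearCombination_single, one_smul] at this
    linear_combination (norm := module) this
  ioio a := by
    have := linearCombination_skeinClass_eq_zero (.ioio (n := n) a) (a := [a, !a])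
      (b := [a, !a]) (sub_mem (single_mem_tangles (by simp) _)
        (add_mem (single_mem_tangles (by simp) _) (single_mem_tangles (by simp) _)))
    simpa only [map_sub, map_add, linearCombination_single, one_smul, sub_eq_zero] using this
  circle a := by
    have := linearCombination_skeinClass_eq_zero (.circle (n := n) a) (a := []) (b := [])
      (sub_mem (single_mem_tangles (by simp) _) (single_mem_tangles (by simp) _))
    simpa only [map_sub, linearCombination_single, one_smul, sub_eq_zero] using this
  loop_right a := by
    have := linearCombination_skeinClass_eq_zero (.loop_right (n := n) a) (a := [a]) (b := [a])
      (sub_mem (single_mem_tangles (by simp) _) (single_mem_tangles (by simp) _))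
    simpa only [map_sub, linearCombination_single, one_smul, sub_eq_zero] using this
  loop_left a := by
    have := linearCombination_skeinClass_eq_zero (.loop_left (n := n) a) (a := [a]) (b := [a])
      (sub_mem (single_mem_tangles (by simp) _) (single_mem_tangles (by simp) _))
    simpa only [map_sub, linearCombination_single, one_smul, sub_eq_zero] using this
  bigon_parallel a := by
    have := linearCombination_skeinClass_eq_zero (.bigon_parallel (n := n) a) (a := [a, a])
      (b := [a, a]) (sub_mem (single_mem_tangles (by simp) _) (single_mem_tangles (by simp) _))
    simpa only [map_sub, linearCombination_single, one_smul, sub_eq_zero] using this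
  bigon_antiparallel a := by
    have := linearCombination_skeinClass_eq_zero (.bigon_antiparallel (n := n) a) (a := [a, !a])
      (b := [a, !a]) (sub_mem (single_mem_tangles (by simp) _)
        (add_mem (single_mem_tangles (by simp) _) (single_mem_tangles (by simp) _)))
    simpa only [map_sub, map_add, linearCombination_single, one_smul, sub_eq_zero] using this
  triangle_acyclic a := by
    have := linearCombination_skeinClass_eq_zero (.triangle_acyclic (n := n) a) (a := [a, a, a])
      (b := [a, a, a])
      (sub_mem (add_mem (single_mem_tangles (by simp) _) (single_mem_tangles (by simp) _))
        (add_mem (single_mem_tangles (by simp) _) (single_mem_tangles (by simp) _)))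
    simpa only [map_sub, map_add, linearCombination_single, one_smul, sub_eq_zero] using this

/-! ### Uniqueness of the evaluation -/

theorem linearCombination_stateSum_eq_zero {N : ℕ} {y : Combination}
    (hy : y ∈ skeinSubmodule (N : ℤ)) : linearCombination ℤ[T;T⁻¹] (stateSum N) y = 0 := by
  suffices h : skeinSubmodule (N : ℤ) ≤ LinearMap.ker (linearCombination ℤ[T;T⁻¹] (stateSum N)) from
    h hy
  refine Submodule.span_le.2 ?_
  rintro _ ⟨c, x, hx, hc, rfl⟩
  rcases (skeinTheory_stateSum N).localRelation hx with rfl | ⟨a, b, u, hu, hne, ht, e⟩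
  · simp
  · have hfit : c.Fits a b := Context.fits_of_closed ht hne (hc u hu)
    have := congrFun e ⟨c, hfit⟩
    rwa [linearCombination_val_apply] at this

theorem Diagram.Evaluates.unique {n : ℤ} (hn : 0 ≤ n) {D : Diagram} {p p' : ℤ[T;T⁻¹]}
    (h : D.Evaluates n p) (h' : D.Evaluates n p') : p = p' := by
  lift n to ℕ using hn
  have e := linearCombination_stateSum_eq_zero h
  have e' := linearCombination_stateSum_eq_zero h'
  simp only [map_sub, linearCombination_single, sub_eq_zero, stateSum, wordValue,
    smul_eq_mul, mul_one] at e e'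
  exact e.symm.trans e'

theorem Diagram.Evaluates.P_eq {n : ℤ} (hn : 0 ≤ n) {D : Diagram} {p : ℤ[T;T⁻¹]}
    (h : D.Evaluates n p) : D.P n = p := by
  have hex : ∃ p, D.Evaluates n p := ⟨p, h⟩
  rw [Diagram.P, dif_pos hex]
  exact hex.choose_spec.unique hn h

/-! ### Mirror images of relations -/

theorem invert_qint (m : ℤ) : invert (qint m) = qint m := by
  apply mul_right_cancel₀ T_one_sub_ne_zero
  have h := congrArg invert (qint_mul m)
  simp only [map_mul, map_sub, invert_T, neg_neg] at h
  rw [qint_mul]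
  linear_combination -h

/-- Switch all crossings and interchange `q` and `q⁻¹`. -/
noncomputable def mirrorMap : Combination →+ Combination :=
  (mapDomain.addMonoidHom (List.map Slice.mirror)).comp
    (mapRange.addMonoidHom (invert : ℤ[T;T⁻¹] ≃ₐ[ℤ] ℤ[T;T⁻¹]).toAddEquiv.toAddMonoidHom)

@[simp] theorem mirrorMap_single (w : Word) (r : ℤ[T;T⁻¹]) :
    mirrorMap (single w r) = single (w.map Slice.mirror) (invert r) := by
  simp [mirrorMap]

theorem mirrorMap_smul (r : ℤ[T;T⁻¹]) (x : Combination) :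
    mirrorMap (r • x) = invert r • mirrorMap x := by
  induction x using Finsupp.induction_linear with
  | zero => simp
  | add x y hx hy => simp only [smul_add, map_add, hx, hy]
  | single w s => simp only [smul_single, mirrorMap_single, smul_eq_mul, map_mul]

theorem mirrorMap_fill (c : Context) (x : Combination) :
    mirrorMap (mapDomain c.fill x) = mapDomain c.mirror.fill (mirrorMap x) := by
  induction x using Finsupp.induction_linear with
  | zero => simp
  | add x y hx hy => simp only [mapDomain_add, map_add, hx, hy]
  | single w s => simp only [mapDomain_single, mirrorMap_single, Context.mirror_fill]

theorem exists_of_mem_support_mirrorMap {x : Combination} {w : Word}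
    (h : w ∈ (mirrorMap x).support) : ∃ u ∈ x.support, u.map Slice.mirror = w := by
  classical
  have := mapDomain_support h
  obtain ⟨u, hu, e⟩ := Finset.mem_image.1 this
  exact ⟨u, support_mapRange (hf := map_zero invert) hu, e⟩

theorem map_mirror_smoothing (a b : Bool) :
    (smoothing a b).map Slice.mirror = smoothing a b := by
  cases a <;> cases b <;> rfl

theorem LocalRelation.mirror {n : ℤ} {x : Combination} (h : LocalRelation n x) :
    LocalRelation n (mirrorMap x) := by
  cases h with
  | planar h => simpa using LocalRelation.planar h.mirror
  | crossing o a b =>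
    have := LocalRelation.crossing (n := n) (!o) a b
    rw [crossingSign_not] at this
    simp only [map_sub, mirrorMap_single, map_mirror_smoothing, map_one, invert_T, ← neg_mul]
    exact this
  | ioio a => simpa only [map_sub, map_add, mirrorMap_single, map_one] using .ioio a
  | circle a =>
    simpa only [map_sub, map_add, mirrorMap_single, map_one, invert_qint] using .circle a
  | loop_right a =>
    simpa only [map_sub, map_add, mirrorMap_single, map_one, invert_qint] using .loop_right a
  | loop_left a =>
    simpa only [map_sub, map_add, mirrorMap_single, map_one, invert_qint] using .loop_left a
  | bigon_parallel a =>
    simpa only [map_sub, map_add, mirrorMap_single, map_one, invert_qint] using .bigon_parallel a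
  | bigon_antiparallel a =>
    simpa only [map_sub, map_add, mirrorMap_single, map_one, invert_qint] using
      .bigon_antiparallel a
  | triangle_acyclic a =>
    simpa only [map_sub, map_add, mirrorMap_single, map_one, invert_qint] using
      .triangle_acyclic a
  | triangle_cyclic a =>
    simpa only [map_sub, map_add, mirrorMap_single, map_one, invert_qint] using .triangle_cyclic a

theorem mirrorMap_mem {n : ℤ} {y : Combination} (hy : y ∈ skeinSubmodule n) :
    mirrorMap y ∈ skeinSubmodule n := by
  induction hy using Submodule.span_induction with
  | mem y h =>
    obtain ⟨c, x, hx, hc, rfl⟩ := h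
    refine Submodule.subset_span
      ⟨c.mirror, mirrorMap x, hx.mirror, fun w hw => ?_, mirrorMap_fill c x⟩
    obtain ⟨u, hu, rfl⟩ := exists_of_mem_support_mirrorMap hw
    rw [← Context.mirror_fill]
    exact (hc u hu).mirror
  | zero => simp
  | add x y _ _ hx hy => rw [map_add]; exact add_mem hx hy
  | smul r x _ hx => rw [mirrorMap_smul]; exact Submodule.smul_mem _ _ hx

theorem Diagram.Evaluates.mirror {n : ℤ} {D : Diagram} {p : ℤ[T;T⁻¹]} (h : D.Evaluates n p) :
    D.mirror.Evaluates n (invert p) := by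
  simpa [Diagram.Evaluates, Diagram.mirror] using mirrorMap_mem h

theorem Diagram.mirror_mirror (D : Diagram) : D.mirror.mirror = D := by
  have h : Slice.mirror ∘ Slice.mirror = id := by
    funext ⟨l, g, r⟩
    rcases g with _ | _ | (_ | _) <;> simp [Slice.mirror, Gen.mirror, Node.mirror]
  simp [Diagram.mirror, h]

theorem Diagram.P_mirror {n : ℤ} (hn : 0 ≤ n) (D : Diagram) :
    D.mirror.P n = invert (D.P n) := by
  by_cases h : ∃ p, D.Evaluates n p
  · obtain ⟨p, h⟩ := h
    rw [h.P_eq hn, h.mirror.P_eq hn]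
  · -- Mirroring twice shows that `D` and its mirror image have evaluations simultaneously.
    have h' : ¬ ∃ p, D.mirror.Evaluates n p := fun ⟨p, hp⟩ =>
      h ⟨_, D.mirror_mirror ▸ hp.mirror⟩
    rw [Diagram.P, Diagram.P, dif_neg h, dif_neg h', map_zero]

/-! ### The polynomial of a knotted graph -/

/-- Diagrams related by a move have the same class, hence evaluate to the same polynomials. -/
theorem Diagram.Step.P_eq {n : ℤ} {D D' : Diagram} (h : D.Step D') : D.P n = D'.P n := by
  have e := (skeinTheory_skeinClass n).invariant h
  have he : D.Evaluates n = D'.Evaluates n := by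
    funext p
    simp only [Diagram.Evaluates, ← Submodule.Quotient.mk_eq_zero, Submodule.Quotient.mk_sub]
    exact congrArg (fun t => t - _ = 0) e
  unfold Diagram.P
  generalize D.Evaluates n = E at he
  subst he
  rfl

theorem Diagram.P_eq_of_graph_eq {n : ℤ} {D : Diagram} {L : KnottedGraph} (h : D.graph = L) :
    D.P n = L.P n :=
  congrArg (Quot.lift (Diagram.P n) fun _ _ => Diagram.Step.P_eq) (h.trans L.out_eq.symm)

end SlGraph

theorem proposition4p2 (n : ℤ) (hn : 2 ≤ n) (L : SlGraph.KnottedGraph) :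
    (∀ D : SlGraph.Diagram, D.graph = L → D.P n = L.P n) ∧
      L.mirror.P n = LaurentPolynomial.invert (L.P n) := by
  refine ⟨fun D => SlGraph.Diagram.P_eq_of_graph_eq, ?_⟩
  have h : (Quot.out L).mirror.graph = L.mirror := congrArg SlGraph.KnottedGraph.mirror L.out_eq
  rw [← SlGraph.Diagram.P_eq_of_graph_eq h]
  exact (Quot.out L).P_mirror (by omega)
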